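/- Let $n\ge 2$, let $M$ be a connected orientable smooth $n$-manifold (possibly with boundary or corners), and let $K\subset M$ be a nonempty closed smooth $(n-2)$-dimensional submanifold, i.e. $K=\iota(N)$ for a smooth $(n-2)$-manifold $N$ (possibly with boundary or corners) and a smooth immersion $\iota\colon N\to M$ that is a homeomorphism onto a closed subset of $M$. Let $\mathrm{Diff}^1_+(M,K)$ be the group of orientation-preserving $C^1$ self-diffeomorphisms of $M$ that fix every point of $K$. Let $\mathbb R^{2(n-2)}\rtimes GL^+(2,\mathbb R)$ be the group of matrices $\begin{pmatrix} I_{n-2} & B\\ 0 & A\end{pmatrix}$ with $B$ a real $(n-2)\times 2$ matrix and $A\in GL^+(2,\mathbb R)$, i.e. of pairs $(C,A)$ with $B=CA$ and $(C,A)(C',A')=(C+C'A^{-1},AA')$. A group $G$ is circularly orderable if there is a function $e\colon G^3\to\{-1,0,1\}$, equal to $\pm1$ on triples of distinct elements and $0$ on all other triples, with $e(b,c,d)-e(a,c,d)+e(a,b,d)-e(a,b,c)=0$ and $e(ga,gb,gc)=e(a,b,c)$ for all $a,b,c,d,g\in G$. It is locally indicable if each of its nontrivial finitely generated subgroups surjects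 onto $\mathbb Z$. Then: 1. $\mathrm{Diff}^1_+(M,K)$ is circularly orderable. 2. $\mathbb R^{2(n-2)}\rtimes GL^+(2,\mathbb R)$ is circularly orderable. 3. For every $k=\iota(x)\in K$ there are linear coordinates $T_kM\cong\mathbb R^{n-2}\times\mathbb R^2$ that carry $T_kK=d\iota_x(T_xN)$ to $\mathbb R^{n-2}\times 0$ and in which $g\mapsto dg|_k$ is a homomorphism $\rho\colon \mathrm{Diff}^1_+(M,K)\to\mathbb R^{2(n-2)}\rtimes GL^+(2,\mathbb R)$ with locally indicable kernel. If $x$ is an interior point of $N$ and $k$ is an interior point of $M$ (in particular, always when $M$ and $N$ have no boundary), then $\rho$ is surjective, so that $\mathrm{Diff}^1_+(M,K)$ is an extension of $\mathbb R^{2(n-2)}\rtimes GL^+(2,\mathbb R)$ by a locally indicable kernel. -/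

import Mathlib

open scoped Manifold ContDiff Topology Matrix MatrixGroups
open Module

noncomputable section

/-! ### Circularly orderable and locally indicable groups -/

/-- A circular order on a set, as a function on all triples: it is `±1` on triples of distinct
elements, `0` on all other triples, and satisfies the cocycle condition. -/
structure IsCircularOrder {S : Type*} (e : S → S → S → ℤ) : Prop where
  distinct : ∀ a b c : S, a ≠ b → b ≠ c → a ≠ c → e a b c = 1 ∨ e a b c = -1
  degenerate : ∀ a b c : S, a = b ∨ b = c ∨ a = c → e a b c = 0
  cocycle : ∀ a b c d : S, e b c d - e a c d + e a b d - e a b c = 0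

/-- A group is circularly orderable if it has a left-invariant circular order. -/
def IsCircularlyOrderable (G : Type*) [Group G] : Prop :=
  ∃ e : G → G → G → ℤ, IsCircularOrder e ∧
    ∀ g a b c : G, e (g * a) (g * b) (g * c) = e a b c

/-- A group is locally indicable if every nontrivial finitely generated subgroup of it
surjects onto `ℤ`. -/
def IsLocallyIndicable (G : Type*) [Group G] : Prop :=
  ∀ H : Subgroup G, H.FG → H ≠ ⊥ →
    ∃ f : H →* Multiplicative ℤ, Function.Surjective f

/-! ### The group `ℝ^{2d} ⋊ GL⁺(2, ℝ)` -/

/-- The matrix of an element of `GL⁺(2, ℝ)`. -/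
def glMatrix : GL(2, ℝ)⁺ →* Matrix (Fin 2) (Fin 2) ℝ where
  toFun A := (A.1 : Matrix (Fin 2) (Fin 2) ℝ)
  map_one' := rfl
  map_mul' _ _ := rfl

theorem glMatrix_inv_mul (A : GL(2, ℝ)⁺) : glMatrix A⁻¹ * glMatrix A = 1 := by
  rw [← map_mul, inv_mul_cancel, map_one]

theorem glMatrix_mul_inv (A : GL(2, ℝ)⁺) : glMatrix A * glMatrix A⁻¹ = 1 := by
  rw [← map_mul, mul_inv_cancel, map_one]

/-- `GL⁺(2, ℝ)` acts on the additive group of `d × 2` matrices by `A • C = C A⁻¹`. -/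
def knotAction (d : ℕ) :
    GL(2, ℝ)⁺ →* MulAut (Multiplicative (Matrix (Fin d) (Fin 2) ℝ)) where
  toFun A := AddEquiv.toMultiplicative
    { toFun := fun C => C * glMatrix A⁻¹
      invFun := fun C => C * glMatrix A
      left_inv := fun C => by beta_reduce; rw [Matrix.mul_assoc, glMatrix_inv_mul, Matrix.mul_one]
      right_inv := fun C => by beta_reduce; rw [Matrix.mul_assoc, glMatrix_mul_inv, Matrix.mul_one]
      map_add' := fun C D => Matrix.add_mul C D _ }
  map_one' := by
    ext C : 1
    show Multiplicative.ofAdd (Multiplicative.toAdd C * glMatrix 1⁻¹) = C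
    rw [inv_one, map_one, Matrix.mul_one]
    rfl
  map_mul' A B := by
    ext C : 1
    show Multiplicative.ofAdd (Multiplicative.toAdd C * glMatrix (A * B)⁻¹) =
      Multiplicative.ofAdd (Multiplicative.toAdd C * glMatrix B⁻¹ * glMatrix A⁻¹)
    rw [mul_inv_rev, map_mul, Matrix.mul_assoc]

/-- The group `ℝ^{2d} ⋊ GL⁺(2, ℝ)`, where `ℝ^{2d}` is the group of `d × 2` matrices. -/
abbrev KnotLinearGroup (d : ℕ) : Type :=
  Multiplicative (Matrix (Fin d) (Fin 2) ℝ) ⋊[knotAction d] GL(2, ℝ)⁺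

/-- The linear action of `ℝ^{2d} ⋊ GL⁺(2, ℝ)` on `ℝ^d × ℝ²`: the element `(C, A)` acts by the
block matrix with rows `(1, C A)` and `(0, A)`. -/
def knotLinearAct {d : ℕ} (p : KnotLinearGroup d) (v : (Fin d → ℝ) × (Fin 2 → ℝ)) :
    (Fin d → ℝ) × (Fin 2 → ℝ) :=
  (v.1 + (Multiplicative.toAdd p.left * glMatrix p.right) *ᵥ v.2, glMatrix p.right *ᵥ v.2)

/-- The block matrices with rows `(1, C A)` and `(0, A)` multiply as in the semidirect product. -/
theorem knotLinearAct_mul {d : ℕ} (p q : KnotLinearGroup d) (v : (Fin d → ℝ) × (Fin 2 → ℝ)) :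
    knotLinearAct (p * q) v = knotLinearAct p (knotLinearAct q v) := by
  have hl : Multiplicative.toAdd (p * q).left = Multiplicative.toAdd p.left +
      Multiplicative.toAdd q.left * glMatrix p.right⁻¹ := rfl
  have hr : glMatrix (p * q).right = glMatrix p.right * glMatrix q.right := rfl
  have key : Multiplicative.toAdd (p * q).left * glMatrix (p * q).right =
      Multiplicative.toAdd p.left * glMatrix p.right * glMatrix q.right +
      Multiplicative.toAdd q.left * glMatrix q.right := by
    rw [hl, hr, Matrix.add_mul, ← Matrix.mul_assoc, Matrix.mul_assoc (Multiplicative.toAdd q.left),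
      ← Matrix.mul_assoc (glMatrix p.right⁻¹), glMatrix_inv_mul, Matrix.one_mul]
  unfold knotLinearAct
  rw [key, hr]
  simp only [Matrix.add_mulVec, Matrix.mulVec_mulVec]
  exact Prod.ext (by simp only; abel) rfl

/-! ### Orientations of manifolds -/

/-- The linear map `L` is an isomorphism that carries the orientation `o` to `o'`. -/
def CarriesOrientation {ι V W : Type*} [AddCommGroup V] [Module ℝ V] [AddCommGroup W]
    [Module ℝ W] (L : V →ₗ[ℝ] W) (o : Orientation ℝ V ι) (o' : Orientation ℝ W ι) : Prop :=
  ∃ e : V ≃ₗ[ℝ] W, (e : V →ₗ[ℝ] W) = L ∧ Orientation.map ι e o = o'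

theorem CarriesOrientation.id {ι V : Type*} [AddCommGroup V] [Module ℝ V]
    (o : Orientation ℝ V ι) : CarriesOrientation LinearMap.id o o :=
  ⟨LinearEquiv.refl ℝ V, rfl, by simp⟩

theorem CarriesOrientation.comp {ι V W U : Type*} [AddCommGroup V] [Module ℝ V] [AddCommGroup W]
    [Module ℝ W] [AddCommGroup U] [Module ℝ U] {L : V →ₗ[ℝ] W} {L' : W →ₗ[ℝ] U}
    {o : Orientation ℝ V ι} {o' : Orientation ℝ W ι} {o'' : Orientation ℝ U ι}
    (h' : CarriesOrientation L' o' o'') (h : CarriesOrientation L o o') :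
    CarriesOrientation (L' ∘ₗ L) o o'' := by
  obtain ⟨e, rfl, rfl⟩ := h
  obtain ⟨e', rfl, rfl⟩ := h'
  refine ⟨e.trans e', rfl, ?_⟩
  induction o using Module.Ray.ind with
  | h v hv => rfl

theorem CarriesOrientation.of_leftInverse {ι V W : Type*} [AddCommGroup V] [Module ℝ V]
    [AddCommGroup W] [Module ℝ W] {L : V →ₗ[ℝ] W} {L' : W →ₗ[ℝ] V}
    {o : Orientation ℝ V ι} {o' : Orientation ℝ W ι}
    (h : CarriesOrientation L o o') (hL : L' ∘ₗ L = LinearMap.id) :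
    CarriesOrientation L' o' o := by
  obtain ⟨e, rfl, rfl⟩ := h
  refine ⟨e.symm, ?_, ?_⟩
  · ext w
    have := LinearMap.congr_fun hL (e.symm w)
    simpa using this.symm
  · rw [← Orientation.map_symm]
    exact Equiv.symm_apply_apply _ _

section Manifolds

variable {E : Type*} [NormedAddCommGroup E] [NormedSpace ℝ E]
  {H : Type*} [TopologicalSpace H] (I : ModelWithCorners ℝ E H)
  {M : Type*} [TopologicalSpace M] [ChartedSpace H M]

/-- A family of orientations of the tangent spaces is an orientation of the manifold if it is
locally constant when it is read in charts. -/
def IsManifoldOrientation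
    (o : ∀ x : M, Orientation ℝ (TangentSpace I x) (Fin (finrank ℝ E))) : Prop :=
  ∀ x₀ : M, ∃ oE : Orientation ℝ E (Fin (finrank ℝ E)), ∀ᶠ x in 𝓝 x₀,
    CarriesOrientation (V := TangentSpace I x) (W := E)
      (mfderiv I 𝓘(ℝ, E) (extChartAt I x₀) x).toLinearMap (o x) oE

variable (M) in
/-- A manifold is orientable if it has an orientation. -/
def IsOrientableManifold : Prop :=
  ∃ o : ∀ x : M, Orientation ℝ (TangentSpace I x) (Fin (finrank ℝ E)), IsManifoldOrientation I o

/-- A map preserves orientation if, for each orientation of the manifold, its differentials carry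
the orientation at `x` to the orientation at the image of `x`. (On a connected orientable manifold
there are two orientations, opposite to each other, and it suffices to look at one of them.) -/
def IsOrientationPreserving (g : M → M) : Prop :=
  ∀ o : ∀ x : M, Orientation ℝ (TangentSpace I x) (Fin (finrank ℝ E)), IsManifoldOrientation I o →
    ∀ x : M, CarriesOrientation (mfderiv I I g x).toLinearMap (o x) (o (g x))

/-! ### Groups of `C¹` diffeomorphisms -/

/-- The `C¹` self-diffeomorphisms of a manifold form a group under composition. -/
instance diffeomorphGroup : Group (M ≃ₘ^1⟮I, I⟯ M) where
  mul g h := h.trans g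
  one := Diffeomorph.refl I M 1
  inv g := g.symm
  mul_assoc _ _ _ := rfl
  one_mul _ := rfl
  mul_one _ := rfl
  inv_mul_cancel g := g.self_trans_symm

/-- `Diff¹₊(M, K)`: the group of orientation-preserving `C¹` self-diffeomorphisms of `M` that fix
every point of `K`. -/
def Diff1Plus (K : Set M) : Subgroup (M ≃ₘ^1⟮I, I⟯ M) where
  carrier := {g | IsOrientationPreserving I g ∧ ∀ x ∈ K, g x = x}
  one_mem' := by
    refine ⟨fun o _ x => ?_, fun _ _ => rfl⟩
    have h : mfderiv I I (fun y : M => y) x = ContinuousLinearMap.id ℝ (TangentSpace I x) :=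
      mfderiv_id
    show CarriesOrientation (mfderiv I I (fun y : M => y) x).toLinearMap (o x) (o x)
    rw [h]
    exact CarriesOrientation.id _
  mul_mem' := by
    rintro g h ⟨hg, hgK⟩ ⟨hh, hhK⟩
    refine ⟨fun o ho x => ?_, fun x hx => ?_⟩
    · have hc : mfderiv I I (⇑g ∘ ⇑h) x = (mfderiv I I g (h x)).comp (mfderiv I I h x) :=
        mfderiv_comp x (g.mdifferentiable one_ne_zero _) (h.mdifferentiable one_ne_zero _)
      show CarriesOrientation (mfderiv I I (⇑g ∘ ⇑h) x).toLinearMap (o x) (o (g (h x)))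
      rw [hc]
      exact (hg o ho (h x)).comp (hh o ho x)
    · show g (h x) = x
      rw [hhK x hx, hgK x hx]
  inv_mem' := by
    rintro g ⟨hg, hgK⟩
    refine ⟨fun o ho y => ?_, fun x hx => ?_⟩
    · obtain ⟨x, rfl⟩ := g.surjective y
      have hc : mfderiv I I (⇑g.symm ∘ ⇑g) x =
          (mfderiv I I g.symm (g x)).comp (mfderiv I I g x) :=
        mfderiv_comp x (g.symm.mdifferentiable one_ne_zero _) (g.mdifferentiable one_ne_zero _)
      have hid : (⇑g.symm ∘ ⇑g) = (fun y : M => y) := funext fun y => g.symm_apply_apply y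
      have hid' : mfderiv I I (⇑g.symm ∘ ⇑g) x = ContinuousLinearMap.id ℝ E := by
        rw [hid]; exact mfderiv_id
      have ho' : (o (g.symm (g x)) : Orientation ℝ E (Fin (finrank ℝ E))) = o x :=
        congrArg (show M → Orientation ℝ E (Fin (finrank ℝ E)) from o) (g.symm_apply_apply x)
      show CarriesOrientation (V := E) (W := E) (mfderiv I I g.symm (g x)).toLinearMap
        (o (g x)) (o (g.symm (g x)))
      rw [ho']
      refine CarriesOrientation.of_leftInverse (V := E) (W := E) (hg o ho x) ?_
      exact congrArg ContinuousLinearMap.toLinearMap (hc.symm.trans hid')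
    · show g.symm x = x
      conv_lhs => rw [← hgK x hx]
      exact g.symm_apply_apply x

/-! ### Closed submanifolds -/

variable {E' : Type*} [NormedAddCommGroup E'] [NormedSpace ℝ E']
  {H' : Type*} [TopologicalSpace H'] (J : ModelWithCorners ℝ E' H')
  {N : Type*} [TopologicalSpace N] [ChartedSpace H' N]

/-- `ι` is a smooth embedding with closed image: a smooth immersion that is a homeomorphism onto a
closed subset. The closed submanifolds of `M` are the images of such maps. -/
structure IsClosedSmoothEmbedding (ι : N → M) : Prop where
  contMDiff : ContMDiff J I ∞ ι
  injective_mfderiv : ∀ x : N, Function.Injective (mfderiv J I ι x)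
  isClosedEmbedding : Topology.IsClosedEmbedding ι

end Manifolds

end

/-! At a point k of K, the differential of each g fixes the codimension-two space T_kK pointwise, so
it is block triangular with an identity block, and preservation of orientation makes the determinant
of its 2 × 2 block positive. This is ρ.

An element of the kernel of ρ fixes k with identity differential, and Thurston's stability theorem
(`exists_surjective_int_of_mfderiv_eq_id`) then gives local indicability. Near a fixed point where
all differentials are the identity, displacements are almost constant at their own scale, so,
divided by the total displacement of the generators, they converge along an ultrafilter of moved
points to a nontrivial homomorphism into a vector space. This needs moved points arbitrarily close
to the base point. If the group fixes a neighbourhood of k, connectedness supplies a base point on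
the frontier of the interior of the fixed set, and continuity of the derivatives shows that all
differentials are the identity there too.

For circular orders, the linear group acts through its GL⁺(2, ℝ) quotient on the rays of the plane,
which the signs of determinants order circularly and invariantly. The stabilizer of a ray is
left-orderable, by logarithms and matrix entries, and `isCircularlyOrderable_of_subgroup` combines
an invariant circular order on cosets with a left order on the subgroup. The same lemma lifts the
circular order along ρ, whose kernel is left-orderable by the Burns–Hale theorem.

For surjectivity at interior points, K lies locally in the zero set of a submersion w to the plane.
With a bump function χ and a small linear map S, the map y ↦ y + S(χ(y) w(y)) is a diffeomorphism
fixing K. Its differentials fill a neighbourhood of the identity, and such a neighbourhood generates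
the linear group. -/

/-- A positive cone of a left-invariant linear order on a group. -/
structure IsPositiveCone {G : Type*} [Group G] (P : Set G) : Prop where
  mul_mem : ∀ {a b : G}, a ∈ P → b ∈ P → a * b ∈ P
  one_notMem : (1 : G) ∉ P
  mem_or_inv_mem : ∀ {a : G}, a ≠ 1 → a ∈ P ∨ a⁻¹ ∈ P

/-- A group is left-orderable if it has a positive cone. -/
def IsLeftOrderable (G : Type*) [Group G] : Prop :=
  ∃ P : Set G, IsPositiveCone P

/-! ### Left orders, the Burns–Hale theorem, and circular orders of extensions -/

section LeftOrder

variable {G : Type*} [Group G]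

/-- If every nontrivial finitely generated subgroup maps nontrivially to `ℝ`, then every finite set
of nontrivial elements can be made positive in a subsemigroup that avoids the identity. -/
theorem exists_subsemigroup_of_finset
    (h : ∀ L : Subgroup G, L.FG → L ≠ ⊥ → ∃ φ : L →* Multiplicative ℝ, φ ≠ 1)
    (F : Finset G) (hF : (1 : G) ∉ F) :
    ∃ S : Subsemigroup G, (1 : G) ∉ S ∧ ∀ g ∈ F, g ∈ S ∨ g⁻¹ ∈ S := by
  classical
  induction F using Finset.strongInduction with
  | H F ih =>
  rcases F.eq_empty_or_nonempty with rfl | ⟨g₀, hg₀⟩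
  · exact ⟨⊥, id, by simp⟩
  have hFL : ∀ g ∈ F, g ∈ Subgroup.closure (F : Set G) := fun g hg => Subgroup.subset_closure hg
  obtain ⟨φ, hφ⟩ := h (Subgroup.closure F) ⟨F, rfl⟩ (fun hbot => hF (by
    have := hFL g₀ hg₀
    rw [hbot, Subgroup.mem_bot] at this
    exact this ▸ hg₀))
  have hex : ∃ g, ∃ hg : g ∈ F, φ ⟨g, hFL g hg⟩ ≠ 1 := by
    by_contra! hcon
    refine hφ (MonoidHom.ext fun x => ?_)
    obtain ⟨x, hx⟩ := x
    induction hx using Subgroup.closure_induction with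
    | mem x hx => exact hcon x hx
    | one => exact map_one φ
    | mul x y hx hy h1 h2 =>
      have : (⟨x * y, mul_mem hx hy⟩ : Subgroup.closure (F : Set G)) = ⟨x, hx⟩ * ⟨y, hy⟩ := rfl
      rw [this, map_mul, h1, h2]; simp
    | inv x hx h1 =>
      have : (⟨x⁻¹, inv_mem hx⟩ : Subgroup.closure (F : Set G)) = ⟨x, hx⟩⁻¹ := rfl
      rw [this, map_inv, h1]; simp
  obtain ⟨g₁, hg₁, hφ₁⟩ := hex
  -- The elements of `F` killed by `φ` form a proper subset, since `g₁` survives. Induction settles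
  -- these, and `φ` itself decides the rest: the new semigroup is positive lexicographically, first
  -- for `φ` and then for `S₀`.
  obtain ⟨S₀, hS₀, hS₀'⟩ := ih
    (F.filter fun g => ∃ hg : g ∈ Subgroup.closure (F : Set G), φ ⟨g, hg⟩ = 1)
    ⟨Finset.filter_subset _ _, fun hsub => by
      obtain ⟨_, h2⟩ := (Finset.mem_filter.1 (hsub hg₁)).2
      exact hφ₁ h2⟩ (fun h1 => hF (Finset.mem_filter.1 h1).1)
  refine ⟨⟨{x | ∃ hx : x ∈ Subgroup.closure (F : Set G),
    1 < φ ⟨x, hx⟩ ∨ (φ ⟨x, hx⟩ = 1 ∧ x ∈ S₀)}, ?_⟩, ?_, ?_⟩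
  · rintro a b ⟨ha, ha'⟩ ⟨hb, hb'⟩
    refine ⟨mul_mem ha hb, ?_⟩
    have : (⟨a * b, mul_mem ha hb⟩ : Subgroup.closure (F : Set G)) = ⟨a, ha⟩ * ⟨b, hb⟩ := rfl
    rw [this, map_mul]
    rcases ha' with ha' | ⟨ha', haS⟩ <;> rcases hb' with hb' | ⟨hb', hbS⟩
    · exact Or.inl (one_lt_mul'' ha' hb')
    · left; rwa [hb', mul_one]
    · left; rwa [ha', one_mul]
    · right; exact ⟨by rw [ha', hb', one_mul], S₀.mul_mem haS hbS⟩
  · rintro ⟨h1, h2⟩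
    have : (⟨1, h1⟩ : Subgroup.closure (F : Set G)) = 1 := rfl
    rw [this, map_one] at h2
    rcases h2 with h2 | ⟨_, h2⟩
    · exact lt_irrefl _ h2
    · exact hS₀ h2
  · intro g hg
    have hinv : (⟨g⁻¹, inv_mem (hFL g hg)⟩ : Subgroup.closure (F : Set G)) = ⟨g, hFL g hg⟩⁻¹ := rfl
    rcases lt_trichotomy (φ ⟨g, hFL g hg⟩) 1 with h1 | h1 | h1
    · right
      refine ⟨inv_mem (hFL g hg), Or.inl ?_⟩
      rw [hinv, map_inv]
      exact one_lt_inv'.2 h1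
    · rcases hS₀' g (Finset.mem_filter.2 ⟨hg, hFL g hg, h1⟩) with h2 | h2
      · exact Or.inl ⟨hFL g hg, Or.inr ⟨h1, h2⟩⟩
      · refine Or.inr ⟨inv_mem (hFL g hg), Or.inr ⟨?_, h2⟩⟩
        rw [hinv, map_inv, h1, inv_one]
    · exact Or.inl ⟨hFL g hg, Or.inl h1⟩

/-- The Burns–Hale theorem: a group whose nontrivial finitely generated subgroups map nontrivially
to `ℝ` is left-orderable. -/
theorem isLeftOrderable_of_forall_fg
    (h : ∀ L : Subgroup G, L.FG → L ≠ ⊥ → ∃ φ : L →* Multiplicative ℝ, φ ≠ 1) :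
    IsLeftOrderable G := by
  classical
  choose S hS1 hS2 using fun F : Finset G =>
    exists_subsemigroup_of_finset h (F.erase 1) (Finset.notMem_erase 1 F)
  -- Compactness: the cone is the limit of the semigroups `S F` along an ultrafilter that contains,
  -- for each `a`, the family of all `F` containing `a`. The ultrafilter property chooses between
  -- `a` and `a⁻¹`.
  let U : Ultrafilter (Finset G) := Ultrafilter.of Filter.atTop
  refine ⟨{g | ∀ᶠ F in (U : Filter (Finset G)), g ∈ S F}, fun ha hb => ?_, fun h1 => ?_, ?_⟩
  · filter_upwards [ha, hb] with F h1 h2 using (S F).mul_mem h1 h2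
  · obtain ⟨F, hF⟩ := Filter.Eventually.exists h1
    exact hS1 F hF
  · intro a ha
    have : ∀ᶠ F in (U : Filter (Finset G)), a ∈ S F ∨ a⁻¹ ∈ S F := by
      have : ∀ᶠ F : Finset G in Filter.atTop, a ∈ F := by
        filter_upwards [Filter.eventually_ge_atTop {a}] with F hF
        exact hF (Finset.mem_singleton_self a)
      filter_upwards [Ultrafilter.of_le Filter.atTop this] with F hF
      exact hS2 F a (Finset.mem_erase.2 ⟨ha, hF⟩)
    exact Ultrafilter.eventually_or.1 this

theorem IsLocallyIndicable.isLeftOrderable (hG : IsLocallyIndicable G) : IsLeftOrderable G := by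
  refine isLeftOrderable_of_forall_fg fun L hL hL' => ?_
  obtain ⟨f, hf⟩ := hG L hL hL'
  refine ⟨(AddMonoidHom.toMultiplicative (Int.castAddHom ℝ)).comp f, fun h1 => ?_⟩
  obtain ⟨x, hx⟩ := hf (Multiplicative.ofAdd 1)
  have := DFunLike.congr_fun h1 x
  rw [MonoidHom.comp_apply, hx] at this
  exact one_ne_zero (α := ℝ) (by simpa using congrArg Multiplicative.toAdd this)

/-- A group with an invariant circular order on the cosets of a left-orderable subgroup is
circularly orderable. -/
theorem isCircularlyOrderable_of_subgroup (K : Subgroup G) (hK : IsLeftOrderable K)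
    (e : G → G → G → ℤ) (he : ∀ g a b c, e (g * a) (g * b) (g * c) = e a b c)
    (hcoc : ∀ a b c d, e b c d - e a c d + e a b d - e a b c = 0)
    (hdist : ∀ a b c, a⁻¹ * b ∉ K → b⁻¹ * c ∉ K → a⁻¹ * c ∉ K → e a b c = 1 ∨ e a b c = -1)
    (hdeg : ∀ a b c, a⁻¹ * b ∈ K ∨ b⁻¹ * c ∈ K ∨ a⁻¹ * c ∈ K → e a b c = 0) :
    IsCircularlyOrderable G := by
  classical
  obtain ⟨P, hP⟩ := hK
  have hPK : ∀ a, a ∈ Subtype.val '' P → a ∈ K := by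
    rintro _ ⟨a, _, rfl⟩; exact a.2
  have h1 : (1 : G) ∉ Subtype.val '' P := by
    rintro ⟨a, ha, ha'⟩
    have : a = 1 := Subtype.ext ha'
    exact hP.one_notMem (this ▸ ha)
  have hmul : ∀ a b, a ∈ Subtype.val '' P → b ∈ Subtype.val '' P → a * b ∈ Subtype.val '' P := by
    rintro _ _ ⟨a, ha, rfl⟩ ⟨b, hb, rfl⟩
    exact ⟨a * b, hP.mul_mem ha hb, rfl⟩
  have htot : ∀ a ∈ K, a ≠ 1 → a ∈ Subtype.val '' P ∨ a⁻¹ ∈ Subtype.val '' P := by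
    intro a ha ha1
    rcases hP.mem_or_inv_mem (a := ⟨a, ha⟩) (fun h => ha1 (congrArg Subtype.val h)) with h | h
    · exact Or.inl ⟨_, h, rfl⟩
    · exact Or.inr ⟨_, h, rfl⟩
  generalize Subtype.val '' P = Q at hPK h1 hmul htot
  -- The sign of an element for the left order of `K`, extended by zero outside `K`.
  let l : G → ℤ := fun a => if a ∈ Q then 1 else if a⁻¹ ∈ Q then -1 else 0
  have hinv : ∀ a, a ∈ Q → a⁻¹ ∉ Q := fun a ha hb => h1 (by simpa using hmul _ _ ha hb)
  have l0 : ∀ a, a ∉ K → l a = 0 := by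
    intro a ha
    have h2 : a⁻¹ ∉ K := fun h => ha (by simpa using K.inv_mem h)
    simp [l, mt (hPK a) ha, mt (hPK _) h2]
  have l1 : l 1 = 0 := by simp [l, h1]
  have linv : ∀ a, l a⁻¹ = - l a := by
    intro a
    by_cases ha : a ∈ Q <;> by_cases hb : a⁻¹ ∈ Q <;> simp [l, ha, hb]
    exact hinv a ha hb
  have lpm : ∀ a ∈ K, a ≠ 1 → l a = 1 ∨ l a = -1 := by
    intro a ha ha1
    by_cases haQ : a ∈ Q
    · simp [l, haQ]
    · have := (htot a ha ha1).resolve_left haQ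
      simp [l, haQ, this]
  have lpos : ∀ a, l a = 1 ↔ a ∈ Q := by
    intro a
    by_cases ha : a ∈ Q <;> by_cases hb : a⁻¹ ∈ Q <;> simp [l, ha, hb]
  have lmul : ∀ a b, l a = 1 → l b = 1 → l (a * b) = 1 := fun a b ha hb =>
    (lpos _).2 (hmul a b ((lpos a).1 ha) ((lpos b).1 hb))
  have lneg : ∀ a b, l a = -1 → l b = -1 → l (a * b) = -1 := fun a b ha hb => by
    have := lmul b⁻¹ a⁻¹ (by rw [linv, hb]; rfl) (by rw [linv, ha]; rfl)
    rw [← mul_inv_rev, linv] at this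
    omega
  clear_value l
  -- The correction is the coboundary of the invariant function (a, b) ↦ l (a⁻¹ b), so the cocycle
  -- identity and invariance survive. It vanishes when the three cosets are distinct and breaks ties
  -- inside a coset otherwise.
  refine ⟨fun a b c => e a b c + l (a⁻¹ * b) + l (b⁻¹ * c) - l (a⁻¹ * c), ⟨?_, ?_, ?_⟩, ?_⟩
  · intro a b c hab hbc hac
    have hab' : a⁻¹ * b ≠ 1 := fun h => hab (inv_mul_eq_one.1 h)
    have hbc' : b⁻¹ * c ≠ 1 := fun h => hbc (inv_mul_eq_one.1 h)
    have hac' : a⁻¹ * c ≠ 1 := fun h => hac (inv_mul_eq_one.1 h)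
    have hprod : a⁻¹ * c = (a⁻¹ * b) * (b⁻¹ * c) := by group
    have hprod2 : b⁻¹ * c = (a⁻¹ * b)⁻¹ * (a⁻¹ * c) := by group
    have hprod3 : a⁻¹ * b = (a⁻¹ * c) * (b⁻¹ * c)⁻¹ := by group
    by_cases h1 : a⁻¹ * b ∈ K <;> by_cases h2 : b⁻¹ * c ∈ K
    · have h3 : a⁻¹ * c ∈ K := hprod ▸ K.mul_mem h1 h2
      rw [hdeg a b c (Or.inl h1)]
      have e1 := lmul (a⁻¹ * b) (b⁻¹ * c)
      have e2 := lneg (a⁻¹ * b) (b⁻¹ * c)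
      rw [← hprod] at e1 e2
      have := lpm _ h1 hab'
      have := lpm _ h2 hbc'
      have := lpm _ h3 hac'
      omega
    · have h3 : a⁻¹ * c ∉ K := fun h => h2 (hprod2 ▸ K.mul_mem (K.inv_mem h1) h)
      rw [hdeg a b c (Or.inl h1), l0 _ h2, l0 _ h3]
      simpa using lpm _ h1 hab'
    · have h3 : a⁻¹ * c ∉ K := fun h => h1 (hprod3 ▸ K.mul_mem h (K.inv_mem h2))
      rw [hdeg a b c (Or.inr (Or.inl h2)), l0 _ h1, l0 _ h3]
      simpa using lpm _ h2 hbc'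
    · by_cases h3 : a⁻¹ * c ∈ K
      · rw [hdeg a b c (Or.inr (Or.inr h3)), l0 _ h1, l0 _ h2]
        have := lpm _ h3 hac'
        omega
      · rw [l0 _ h1, l0 _ h2, l0 _ h3]
        simpa using hdist a b c h1 h2 h3
  · rintro a b c (rfl | rfl | rfl)
    · have := hdeg a a c (by simp)
      simp [this, l1]
    · have := hdeg a b b (by simp)
      simp [this, l1]
    · have h2 := hdeg a b a (by simp)
      have h3 := linv (a⁻¹ * b)
      rw [mul_inv_rev, inv_inv] at h3
      simp [h2, l1, h3]
  · intro a b c d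
    have := hcoc a b c d
    omega
  · intro g a b c
    have : ∀ x y : G, (g * x)⁻¹ * (g * y) = x⁻¹ * y := fun x y => by group
    simp only [he, this]

/-- A group that maps to a circularly orderable group with left-orderable kernel is circularly
orderable. -/
theorem IsCircularlyOrderable.of_hom {Q : Type*} [Group Q] (hQ : IsCircularlyOrderable Q)
    (f : G →* Q) (hf : IsLeftOrderable f.ker) : IsCircularlyOrderable G := by
  obtain ⟨e, he, he'⟩ := hQ
  have hker : ∀ a b, a⁻¹ * b ∈ f.ker ↔ f a = f b := fun a b => by
    rw [MonoidHom.mem_ker, map_mul, map_inv, inv_mul_eq_one]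
  refine isCircularlyOrderable_of_subgroup f.ker hf (fun a b c => e (f a) (f b) (f c))
    (fun g a b c => by simp only [map_mul, he']) (fun a b c d => he.cocycle _ _ _ _) ?_ ?_
  · intro a b c
    simp only [hker]
    exact he.distinct _ _ _
  · intro a b c
    simp only [hker]
    exact he.degenerate _ _ _

end LeftOrder

/-! ### The circular order of the rays of the plane -/

section RayOrder

/-- The determinant of two vectors of the plane. -/
def planeDet (u v : Fin 2 → ℝ) : ℝ := u 0 * v 1 - u 1 * v 0

/-- The sign of the determinant of two vectors of the plane. -/
noncomputable def planeSign (u v : Fin 2 → ℝ) : ℤ := (SignType.sign (planeDet u v) : ℤ)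

/-- The circular order of the rays spanned by three nonzero vectors of the plane. -/
noncomputable def rayOrder (u v w : Fin 2 → ℝ) : ℤ :=
  Int.sign (planeSign u v + planeSign v w - planeSign u w)

/-- The vector lies in the upper half-plane or on the positive half of the first axis. -/
def IsUpper (u : Fin 2 → ℝ) : Prop := 0 < u 1 ∨ (u 1 = 0 ∧ 0 < u 0)

open Classical in
/-- `1` on upper vectors, `-1` on all others. -/
noncomputable def halfSign (u : Fin 2 → ℝ) : ℤ := if IsUpper u then 1 else -1

theorem halfSign_eq (u : Fin 2 → ℝ) : halfSign u = 1 ∨ halfSign u = -1 := by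
  unfold halfSign; split_ifs <;> simp

theorem isUpper_halfSign_smul {u : Fin 2 → ℝ} (hu : u ≠ 0) :
    IsUpper ((halfSign u : ℝ) • u) := by
  by_cases h : IsUpper u
  · simp [halfSign, h]
  · simp only [halfSign, h, if_false]
    unfold IsUpper at h ⊢
    push Not at h
    rcases lt_or_eq_of_le h.1 with h1 | h1
    · left; simpa using h1
    · right
      have h2 := h.2 h1
      refine ⟨by simp [h1], ?_⟩
      rcases lt_or_eq_of_le h2 with h3 | h3
      · simpa using h3
      · exact absurd (funext fun i => by fin_cases i <;> simp [h1, h3]) hu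

theorem planeDet_smul (a b : ℝ) (u v : Fin 2 → ℝ) :
    planeDet (a • u) (b • v) = a * b * planeDet u v := by
  simp [planeDet]; ring

theorem planeDet_swap (u v : Fin 2 → ℝ) : planeDet v u = - planeDet u v := by
  simp [planeDet]; ring

theorem planeSign_swap (u v : Fin 2 → ℝ) : planeSign v u = - planeSign u v := by
  rw [planeSign, planeSign, planeDet_swap, Left.sign_neg]; simp

theorem planeSign_self (u : Fin 2 → ℝ) : planeSign u u = 0 := by
  have : planeDet u u = 0 := by simp [planeDet]; ring
  simp [planeSign, this]

theorem planeSign_smul_left {t : ℝ} (ht : 0 < t) (u v : Fin 2 → ℝ) :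
    planeSign (t • u) v = planeSign u v := by
  have := planeDet_smul t 1 u v
  rw [one_smul, mul_one] at this
  rw [planeSign, planeSign, this, sign_mul, sign_pos ht, one_mul]

theorem planeSign_smul_left_neg {t : ℝ} (ht : t < 0) (u v : Fin 2 → ℝ) :
    planeSign (t • u) v = - planeSign u v := by
  have := planeDet_smul t 1 u v
  rw [one_smul, mul_one] at this
  rw [planeSign, planeSign, this, sign_mul, sign_neg ht]; simp

theorem planeSign_smul_right {t : ℝ} (ht : 0 < t) (u v : Fin 2 → ℝ) :
    planeSign u (t • v) = planeSign u v := by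
  rw [planeSign_swap, planeSign_smul_left ht, ← planeSign_swap]

theorem planeSign_smul_right_neg {t : ℝ} (ht : t < 0) (u v : Fin 2 → ℝ) :
    planeSign u (t • v) = - planeSign u v := by
  rw [planeSign_swap, planeSign_smul_left_neg ht, ← planeSign_swap]

theorem planeSign_eq (u v : Fin 2 → ℝ) : planeSign u v = 1 ∨ planeSign u v = 0 ∨
    planeSign u v = -1 := by
  unfold planeSign
  cases SignType.sign (planeDet u v) <;> simp

theorem planeSign_nonneg {u v : Fin 2 → ℝ} : 0 ≤ planeSign u v ↔ 0 ≤ planeDet u v := by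
  rcases lt_trichotomy (planeDet u v) 0 with h | h | h <;>
    simp [planeSign, h, le_of_lt]

theorem planeSign_eq_zero {u v : Fin 2 → ℝ} : planeSign u v = 0 ↔ planeDet u v = 0 := by
  rcases lt_trichotomy (planeDet u v) 0 with h | h | h <;>
    simp [planeSign, h, ne_of_gt, ne_of_lt]

theorem planeSign_halfSign (u v : Fin 2 → ℝ) : planeSign u v =
    halfSign u * halfSign v * planeSign ((halfSign u : ℝ) • u) ((halfSign v : ℝ) • v) := by
  rcases halfSign_eq u with h | h <;> rcases halfSign_eq v with h' | h' <;> rw [h, h'] <;>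
    simp [planeSign_smul_left_neg (neg_one_lt_zero (R := ℝ)),
      planeSign_smul_right_neg (neg_one_lt_zero (R := ℝ)), -neg_smul]

/-- Upper vectors have angles in [0, π), where a nonnegative determinant means that the angles are
in order. The proof rests on a linear relation between the three determinants whose coefficients are
the nonnegative second coordinates. The relation is useless when `v` lies on the axis, but then `u`
is forced onto the axis as well. -/
theorem IsUpper.planeDet_trans {u v w : Fin 2 → ℝ} (hu : IsUpper u) (hv : IsUpper v)
    (hw : IsUpper w) (huv : 0 ≤ planeDet u v) (hvw : 0 ≤ planeDet v w) :
    0 ≤ planeDet u w ∧ (planeDet u w = 0 → planeDet u v = 0 ∧ planeDet v w = 0) := by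
  have key : v 1 * planeDet u w = w 1 * planeDet u v + u 1 * planeDet v w := by
    simp [planeDet]; ring
  have hu1 : 0 ≤ u 1 := by rcases hu with h | h; exacts [h.le, h.1.ge]
  have hw1 : 0 ≤ w 1 := by rcases hw with h | h; exacts [h.le, h.1.ge]
  rcases hv with hv | ⟨hv, hv0⟩
  · refine ⟨?_, fun h0 => ?_⟩
    · refine nonneg_of_mul_nonneg_right (b := planeDet u w) (a := v 1) ?_ hv
      rw [key]; positivity
    · rw [h0, mul_zero] at key
      have k1 : w 1 * planeDet u v = 0 := by nlinarith [mul_nonneg hw1 huv, mul_nonneg hu1 hvw]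
      have k2 : u 1 * planeDet v w = 0 := by nlinarith [mul_nonneg hw1 huv, mul_nonneg hu1 hvw]
      constructor
      · rcases mul_eq_zero.1 k1 with h | h
        · rcases hw with hw | ⟨_, hw⟩
          · exact absurd h hw.ne'
          · have := mul_pos hv hw
            simp only [planeDet, h] at hvw
            linarith
        · exact h
      · rcases mul_eq_zero.1 k2 with h | h
        · rcases hu with hu | ⟨_, hu⟩
          · exact absurd h hu.ne'
          · have k3 := mul_pos hu hv
            rcases mul_eq_zero.1 k1 with h' | h'
            · rcases hw with hw | ⟨_, hw⟩
              · exact absurd h' hw.ne'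
              · have := mul_pos hv hw
                simp only [planeDet, h'] at hvw
                linarith
            · simp only [planeDet, h] at h'
              linarith
        · exact h
  · have hu0 : u 1 = 0 := by
      simp only [planeDet, hv] at huv
      nlinarith
    have hu00 : 0 < u 0 := by
      rcases hu with h | h
      · exact absurd hu0 h.ne'
      · exact h.2
    simp only [planeDet, hv, hu0]
    refine ⟨by nlinarith [mul_nonneg hu00.le hw1], fun h => ⟨by ring, ?_⟩⟩
    have : w 1 = 0 := by
      have : u 0 * w 1 = 0 := by linarith
      exact (mul_eq_zero.1 this).resolve_left hu00.ne'
    rw [this]; ring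

theorem IsUpper.planeSign_trans {u v w : Fin 2 → ℝ} (hu : IsUpper u) (hv : IsUpper v)
    (hw : IsUpper w) (huv : 0 ≤ planeSign u v) (hvw : 0 ≤ planeSign v w) :
    0 ≤ planeSign u w ∧ (planeSign u w = 0 → planeSign u v = 0 ∧ planeSign v w = 0) := by
  simp only [planeSign_eq_zero, planeSign_nonneg] at *
  exact hu.planeDet_trans hv hw huv hvw

/-- The linear preorder of the rays of the plane in which the upper rays come first. -/
noncomputable def rayCompare (u v : Fin 2 → ℝ) : ℤ :=
  if halfSign u = halfSign v then planeSign u v else halfSign u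

/-- Cutting the circle at the positive first axis turns the circular order into a linear preorder.
The right side is a coboundary, which yields the cocycle identity at once, while the left side shows
the invariance under GL⁺(2, ℝ). After replacing the vectors by upper ones, only finitely many sign
patterns remain; transitivity in the two directions (`t1`, `t2`) excludes the impossible ones. -/
theorem rayOrder_eq_rayCompare {u v w : Fin 2 → ℝ} (hu : u ≠ 0) (hv : v ≠ 0) (hw : w ≠ 0) :
    rayOrder u v w = rayCompare u v + rayCompare v w - rayCompare u w := by
  have hu' := isUpper_halfSign_smul hu
  have hv' := isUpper_halfSign_smul hv
  have hw' := isUpper_halfSign_smul hw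
  have t1 := hu'.planeSign_trans hv' hw'
  have t2 := hw'.planeSign_trans hv' hu'
  rw [planeSign_swap ((halfSign v : ℝ) • v) ((halfSign w : ℝ) • w),
    planeSign_swap ((halfSign u : ℝ) • u) ((halfSign v : ℝ) • v),
    planeSign_swap ((halfSign u : ℝ) • u) ((halfSign w : ℝ) • w)] at t2
  have a1 := planeSign_eq ((halfSign u : ℝ) • u) ((halfSign v : ℝ) • v)
  have a2 := planeSign_eq ((halfSign v : ℝ) • v) ((halfSign w : ℝ) • w)
  have a3 := planeSign_eq ((halfSign u : ℝ) • u) ((halfSign w : ℝ) • w)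
  unfold rayOrder rayCompare
  rw [planeSign_halfSign u v, planeSign_halfSign v w, planeSign_halfSign u w]
  generalize planeSign ((halfSign u : ℝ) • u) ((halfSign v : ℝ) • v) = a at *
  generalize planeSign ((halfSign v : ℝ) • v) ((halfSign w : ℝ) • w) = b at *
  generalize planeSign ((halfSign u : ℝ) • u) ((halfSign w : ℝ) • w) = c at *
  have e1 := halfSign_eq u
  have e2 := halfSign_eq v
  have e3 := halfSign_eq w
  clear hu hv hw hu' hv' hw'
  generalize halfSign u = x at *
  generalize halfSign v = y at *
  generalize halfSign w = z at *
  rcases a1 with rfl | rfl | rfl <;> rcases a2 with rfl | rfl | rfl <;>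
    rcases a3 with rfl | rfl | rfl <;> first
    | (exfalso; omega)
    | (clear t1 t2
       rcases e1 with rfl | rfl <;> rcases e2 with rfl | rfl <;> rcases e3 with rfl | rfl <;> rfl)

theorem rayOrder_cocycle {a b c d : Fin 2 → ℝ} (ha : a ≠ 0) (hb : b ≠ 0) (hc : c ≠ 0)
    (hd : d ≠ 0) :
    rayOrder b c d - rayOrder a c d + rayOrder a b d - rayOrder a b c = 0 := by
  rw [rayOrder_eq_rayCompare hb hc hd, rayOrder_eq_rayCompare ha hc hd,
    rayOrder_eq_rayCompare ha hb hd, rayOrder_eq_rayCompare ha hb hc]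
  ring

theorem exists_eq_smul_of_planeDet_eq_zero {u v : Fin 2 → ℝ} (hu : u ≠ 0)
    (h : planeDet u v = 0) : ∃ t : ℝ, v = t • u := by
  unfold planeDet at h
  by_cases h0 : u 0 = 0
  · have h1 : u 1 ≠ 0 := fun h1 => hu (funext fun i => by fin_cases i <;> simp [h0, h1])
    refine ⟨v 1 / u 1, funext fun i => ?_⟩
    fin_cases i
    · have : v 0 = 0 := by
        have : u 1 * v 0 = 0 := by rw [h0] at h; linarith
        exact (mul_eq_zero.1 this).resolve_left h1
      simp [h0, this]
    · simp [h1]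
  · refine ⟨v 0 / u 0, funext fun i => ?_⟩
    fin_cases i
    · simp [h0]
    · simp only [Fin.mk_one, Pi.smul_apply, smul_eq_mul]
      field_simp
      linarith

theorem exists_eq_neg_smul {u v : Fin 2 → ℝ} (hu : u ≠ 0) (hv : v ≠ 0)
    (h : planeSign u v = 0) (hr : ¬ ∃ t : ℝ, 0 < t ∧ v = t • u) :
    ∃ t : ℝ, t < 0 ∧ v = t • u := by
  obtain ⟨t, rfl⟩ := exists_eq_smul_of_planeDet_eq_zero hu (planeSign_eq_zero.1 h)
  rcases lt_trichotomy t 0 with ht | rfl | ht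
  · exact ⟨t, ht, rfl⟩
  · simp at hv
  · exact absurd ⟨t, ht, rfl⟩ hr

theorem rayOrder_of_distinct {u v w : Fin 2 → ℝ} (hu : u ≠ 0) (hv : v ≠ 0) (hw : w ≠ 0)
    (huv : ¬ ∃ t : ℝ, 0 < t ∧ v = t • u) (hvw : ¬ ∃ t : ℝ, 0 < t ∧ w = t • v)
    (huw : ¬ ∃ t : ℝ, 0 < t ∧ w = t • u) : rayOrder u v w = 1 ∨ rayOrder u v w = -1 := by
  have huv' := exists_eq_neg_smul hu hv (hr := huv)
  have hvw' := exists_eq_neg_smul hv hw (hr := hvw)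
  have huw' := exists_eq_neg_smul hu hw (hr := huw)
  have a1 := planeSign_eq u v
  have a2 := planeSign_eq v w
  have a3 := planeSign_eq u w
  -- If no sign vanishes, the sum is odd. If one vanishes, those two rays are opposite, and the sum
  -- is plus or minus twice one of the other signs; two coincidences would make two rays equal.
  have hne : planeSign u v + planeSign v w - planeSign u w ≠ 0 := by
    by_cases h1 : planeSign u v = 0
    · obtain ⟨t, ht, rfl⟩ := huv' h1
      rw [planeSign_smul_left_neg ht] at *
      by_cases h3 : planeSign u w = 0
      · obtain ⟨t', ht', rfl⟩ := huw' h3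
        refine absurd ⟨t' / t, div_pos_of_neg_of_neg ht' ht, ?_⟩ hvw
        rw [smul_smul, div_mul_cancel₀ _ ht.ne]
      · omega
    · by_cases h2 : planeSign v w = 0
      · obtain ⟨t, ht, rfl⟩ := hvw' h2
        rw [planeSign_smul_right_neg ht, planeSign_self, planeSign_smul_right_neg ht]
        omega
      · by_cases h3 : planeSign u w = 0
        · obtain ⟨t, ht, rfl⟩ := huw' h3
          rw [planeSign_smul_right_neg ht, planeSign_smul_right_neg ht, planeSign_self,
            planeSign_swap u v]
          omega
        · omega
  unfold rayOrder
  rcases lt_or_gt_of_ne hne with h | h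
  · exact Or.inr (Int.sign_eq_neg_one_of_neg h)
  · exact Or.inl (Int.sign_eq_one_of_pos h)

theorem rayOrder_of_degenerate {u v w : Fin 2 → ℝ}
    (h : (∃ t : ℝ, 0 < t ∧ v = t • u) ∨ (∃ t : ℝ, 0 < t ∧ w = t • v) ∨
      ∃ t : ℝ, 0 < t ∧ w = t • u) : rayOrder u v w = 0 := by
  unfold rayOrder
  rcases h with ⟨t, ht, rfl⟩ | ⟨t, ht, rfl⟩ | ⟨t, ht, rfl⟩
  · simp [planeSign_smul_left ht, planeSign_smul_right ht, planeSign_self]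
  · simp [planeSign_smul_right ht, planeSign_self]
  · simp [planeSign_smul_right ht, planeSign_self, planeSign_swap u v]

theorem planeSign_mulVec {A : Matrix (Fin 2) (Fin 2) ℝ} (hA : 0 < A.det) (u v : Fin 2 → ℝ) :
    planeSign (A *ᵥ u) (A *ᵥ v) = planeSign u v := by
  have : planeDet (A *ᵥ u) (A *ᵥ v) = A.det * planeDet u v := by
    simp [planeDet, Matrix.det_fin_two, Matrix.mulVec, dotProduct, Fin.sum_univ_two]; ring
  rw [planeSign, planeSign, this, sign_mul, sign_pos hA, one_mul]

theorem rayOrder_mulVec {A : Matrix (Fin 2) (Fin 2) ℝ} (hA : 0 < A.det) (u v w : Fin 2 → ℝ) :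
    rayOrder (A *ᵥ u) (A *ᵥ v) (A *ᵥ w) = rayOrder u v w := by
  simp only [rayOrder, planeSign_mulVec hA]

end RayOrder

/-! ### Circular orderability of the linear group -/

section KnotLinearGroup

variable {d : ℕ}

theorem glMatrix_det_pos (A : GL(2, ℝ)⁺) : 0 < (glMatrix A).det := A.2

theorem glMatrix_injective : Function.Injective glMatrix := fun _ _ h => Subtype.ext (Units.ext h)

/-- The element of `GL⁺(2, ℝ)` with a given matrix. -/
noncomputable def glOfMatrix (A : Matrix (Fin 2) (Fin 2) ℝ) (hA : 0 < A.det) : GL(2, ℝ)⁺ :=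
  ⟨Matrix.GeneralLinearGroup.mkOfDetNeZero A hA.ne', hA⟩

@[simp] theorem glMatrix_glOfMatrix (A : Matrix (Fin 2) (Fin 2) ℝ) (hA : 0 < A.det) :
    glMatrix (glOfMatrix A hA) = A := rfl

theorem KnotLinearGroup.glMatrix_mul_right (p q : KnotLinearGroup d) :
    glMatrix (p * q).right = glMatrix p.right * glMatrix q.right := rfl

/-- The stabilizer of the ray of the first basis vector of the plane. -/
def rayStabilizer (d : ℕ) : Subgroup (KnotLinearGroup d) where
  carrier := {p | glMatrix p.right 1 0 = 0 ∧ 0 < glMatrix p.right 0 0}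
  one_mem' := by
    simp
  mul_mem' := by
    rintro p q ⟨hp, hp'⟩ ⟨hq, hq'⟩
    simp only [Set.mem_ofPred_eq, KnotLinearGroup.glMatrix_mul_right, Matrix.mul_apply,
      Fin.sum_univ_two, hp, hq]
    exact ⟨by simp, by simpa using mul_pos hp' hq'⟩
  inv_mem' := by
    rintro p ⟨hp, hp'⟩
    have h := glMatrix_inv_mul p.right
    have h0 := congrFun (congrFun h 0) 0
    have h1 := congrFun (congrFun h 1) 0
    simp only [Matrix.mul_apply, Fin.sum_univ_two, hp, mul_zero, add_zero, Matrix.one_apply_eq]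
      at h0 h1
    refine ⟨(mul_eq_zero.1 (h1.trans (by simp))).resolve_right hp'.ne', ?_⟩
    exact pos_of_mul_pos_left (h0.symm ▸ one_pos) hp'.le

/-- The stabilizer consists of upper triangular blocks with positive diagonal, so logarithms of the
diagonal entries are homomorphisms. On a subgroup where these vanish the off-diagonal entry is
additive, and where that vanishes too the entries of the left component are. Hence every nontrivial
subgroup, finitely generated or not, has a nontrivial homomorphism to ℝ. -/
theorem isLeftOrderable_rayStabilizer (d : ℕ) : IsLeftOrderable (rayStabilizer d) := by
  have key : ∀ L : Subgroup (rayStabilizer d), L ≠ ⊥ →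
      ∃ φ : L →* Multiplicative ℝ, φ ≠ 1 := by
    intro L hL
    by_contra! hcon
    have hA : ∀ x : L, glMatrix x.1.1.right 1 0 = 0 := fun x => x.1.2.1
    have h00 : ∀ x : L, 0 < glMatrix x.1.1.right 0 0 := fun x => x.1.2.2
    have h11 : ∀ x : L, 0 < glMatrix x.1.1.right 1 1 := fun x => by
      have := glMatrix_det_pos x.1.1.right
      rw [Matrix.det_fin_two, hA, mul_zero, sub_zero] at this
      exact pos_of_mul_pos_right this (h00 x).le
    have hmul : ∀ x y : L, glMatrix (x * y).1.1.right =
      glMatrix x.1.1.right * glMatrix y.1.1.right := fun _ _ => rfl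
    have vanish : ∀ f : L → ℝ, (∀ x y, f (x * y) = f x + f y) → ∀ x, f x = 0 := fun f hf x =>
      congrArg Multiplicative.toAdd (DFunLike.congr_fun
        (hcon (MonoidHom.mk' (fun x => Multiplicative.ofAdd (f x)) fun x y =>
          congrArg Multiplicative.ofAdd (hf x y))) x)
    have log0 := vanish (fun x => Real.log (glMatrix x.1.1.right 0 0)) fun x y => by
      rw [hmul, Matrix.mul_apply, Fin.sum_univ_two, hA y, mul_zero, add_zero,
        Real.log_mul (h00 x).ne' (h00 y).ne']
    have log1 := vanish (fun x => Real.log (glMatrix x.1.1.right 1 1)) fun x y => by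
      rw [hmul, Matrix.mul_apply, Fin.sum_univ_two, hA x, zero_mul, zero_add,
        Real.log_mul (h11 x).ne' (h11 y).ne']
    have e00 : ∀ x : L, glMatrix x.1.1.right 0 0 = 1 := fun x =>
      Real.eq_one_of_pos_of_log_eq_zero (h00 x) (log0 x)
    have e11 : ∀ x : L, glMatrix x.1.1.right 1 1 = 1 := fun x =>
      Real.eq_one_of_pos_of_log_eq_zero (h11 x) (log1 x)
    have e01 := vanish (fun x => glMatrix x.1.1.right 0 1) fun x y => by
      rw [hmul, Matrix.mul_apply, Fin.sum_univ_two, e00, e11]; ring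
    have hone : ∀ x : L, x.1.1.right = 1 := fun x => glMatrix_injective <| by
      rw [map_one]
      ext i j
      fin_cases i <;> fin_cases j <;> simp [e00, e11, e01, hA]
    have hleft : ∀ i j, ∀ x : L, Multiplicative.toAdd x.1.1.left i j = 0 := fun i j =>
      vanish (fun x => Multiplicative.toAdd x.1.1.left i j) fun x y => by
        have : Multiplicative.toAdd (x * y).1.1.left = Multiplicative.toAdd x.1.1.left +
          Multiplicative.toAdd y.1.1.left * glMatrix x.1.1.right⁻¹ := rfl
        rw [this, hone x, inv_one, map_one, Matrix.mul_one, Matrix.add_apply]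
    refine hL ((Subgroup.eq_bot_iff_forall _).2 fun x hx =>
      Subtype.ext (SemidirectProduct.ext ?_ ?_))
    · exact Multiplicative.toAdd.injective (Matrix.ext fun i j => hleft i j ⟨x, hx⟩)
    · exact hone ⟨x, hx⟩
  exact isLeftOrderable_of_forall_fg fun L _ hL => key L hL

/-- Cosets of the ray stabilizer correspond to rays through the orbit of the first basis vector,
that is, through the first columns `v p`. -/
theorem isCircularlyOrderable_knotLinearGroup (d : ℕ) :
    IsCircularlyOrderable (KnotLinearGroup d) := by
  let v : KnotLinearGroup d → Fin 2 → ℝ := fun p => glMatrix p.right *ᵥ Pi.single 0 1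
  have hvmul : ∀ p q, v (p * q) = glMatrix p.right *ᵥ v q := fun p q => by
    simp only [v, Matrix.mulVec_mulVec]; rfl
  have hv : ∀ p, v p ≠ 0 := fun p h => by
    have h1 := hvmul p⁻¹ p
    rw [h, Matrix.mulVec_zero, inv_mul_cancel] at h1
    have h2 : v 1 = Pi.single 0 1 := Matrix.one_mulVec _
    have := congrFun (h2.symm.trans h1) 0
    simp at this
  have hmem : ∀ p, p ∈ rayStabilizer d ↔ ∃ t : ℝ, 0 < t ∧ v p = t • v 1 := fun p => by
    have h2 : v 1 = Pi.single 0 1 := Matrix.one_mulVec _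
    have h3 : v p = fun i => glMatrix p.right i 0 := by simp [v]; rfl
    rw [h2, h3]
    constructor
    · rintro ⟨h0, h1⟩
      exact ⟨_, h1, funext fun i => by fin_cases i <;> simp [h0]⟩
    · rintro ⟨t, ht, h⟩
      have e0 := congrFun h 0
      have e1 := congrFun h 1
      simp only [Pi.smul_apply, Pi.single_eq_same, smul_eq_mul, mul_one] at e0
      exact ⟨by simpa using e1, e0.symm ▸ ht⟩
  have hrel : ∀ p q, p⁻¹ * q ∈ rayStabilizer d ↔ ∃ t : ℝ, 0 < t ∧ v q = t • v p := fun p q => by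
    rw [hmem]
    refine exists_congr fun t => and_congr_right fun _ => ?_
    constructor
    · intro h
      have := congrArg (glMatrix p.right *ᵥ ·) h
      simp only [Matrix.mulVec_smul] at this
      rwa [← hvmul, ← hvmul, mul_inv_cancel_left, mul_one] at this
    · intro h
      rw [hvmul, h, Matrix.mulVec_smul, ← hvmul, inv_mul_cancel]
  refine isCircularlyOrderable_of_subgroup (rayStabilizer d) (isLeftOrderable_rayStabilizer d)
    (fun p q r => rayOrder (v p) (v q) (v r)) ?_ ?_ ?_ ?_
  · intro g a b c
    simp only [hvmul]
    exact rayOrder_mulVec (glMatrix_det_pos _) _ _ _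
  · exact fun a b c d => rayOrder_cocycle (hv a) (hv b) (hv c) (hv d)
  · intro a b c
    simp only [hrel]
    exact rayOrder_of_distinct (hv a) (hv b) (hv c)
  · intro a b c
    simp only [hrel]
    exact rayOrder_of_degenerate

end KnotLinearGroup

/-! ### Thurston's stability theorem, at interior and boundary points alike -/

section Thurston

variable {E : Type*} [NormedAddCommGroup E] [NormedSpace ℝ E]

/-- A finitely generated group with a nontrivial homomorphism to a real vector space surjects
onto `ℤ`. -/
theorem exists_surjective_int_of_ne_one {Γ : Type*} [Group Γ] [Group.FG Γ]
    (φ : Γ →* Multiplicative E) (hφ : φ ≠ 1) :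
    ∃ f : Γ →* Multiplicative ℤ, Function.Surjective f := by
  let ψ : Additive Γ →+ E := MonoidHom.toAdditiveLeft φ
  have : AddGroup.FG ψ.range := AddGroup.fg_range ψ
  have : Module.Finite ℤ ψ.range := Module.Finite.iff_addGroup_fg.2 inferInstance
  have : IsAddTorsionFree E := ⟨fun n hn x y h => by
    have h' : (n : ℝ) • x = (n : ℝ) • y := by simpa only [Nat.cast_smul_eq_nsmul] using h
    exact smul_right_injective E (Nat.cast_ne_zero.2 hn) h'⟩
  have : Module.Free ℤ ψ.range := inferInstance
  have hne : Nontrivial ψ.range := by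
    obtain ⟨x, hx⟩ : ∃ x, φ x ≠ 1 := by
      by_contra! h
      exact hφ (MonoidHom.ext h)
    exact ⟨⟨ψ (Additive.ofMul x), _, rfl⟩, 0, fun h => hx (congrArg Subtype.val h)⟩
  -- The image is finitely generated and torsion-free, hence free, and nonzero; a coordinate of a
  -- basis is the required surjection.
  let b := Module.Free.chooseBasis ℤ ψ.range
  obtain ⟨i⟩ : Nonempty (Module.Free.ChooseBasisIndex ℤ ψ.range) := b.index_nonempty
  let c : Additive Γ →+ ℤ := (b.coord i).toAddMonoidHom.comp ψ.rangeRestrict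
  refine ⟨MonoidHom.toAdditiveLeft.symm c, fun n => ?_⟩
  obtain ⟨y, hy⟩ := ψ.rangeRestrict_surjective ((Multiplicative.toAdd n) • b i)
  refine ⟨y.toMul, ?_⟩
  have : c y = Multiplicative.toAdd n := by
    simp only [c, AddMonoidHom.comp_apply, hy]
    simp
  exact congrArg Multiplicative.ofAdd this

/-- Thurston's stability argument, along a filter: if the displacements of the maps `f γ` have
arbitrarily small Lipschitz constants, then their normalised limit is a nontrivial
homomorphism. -/
theorem exists_hom_ne_one_of_lipschitz_displacement [FiniteDimensional ℝ E] {Γ : Type*} [Group Γ]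
    (S : Finset Γ) (hS : Subgroup.closure (S : Set Γ) = ⊤) (𝓕 : Filter E) (f : Γ → E → E)
    (hone : ∀ᶠ y in 𝓕, f 1 y = y)
    (hmul : ∀ γ δ, ∀ᶠ y in 𝓕, f (γ * δ) y = f γ (f δ y))
    (htendsto : ∀ γ, Filter.Tendsto (f γ) 𝓕 𝓕)
    (hlip : ∀ γ, ∀ K : NNReal, 0 < K → ∃ t ∈ 𝓕, LipschitzOnWith K (fun y => f γ y - y) t)
    (hne : ∃ᶠ y in 𝓕, ∃ s ∈ S, f s y ≠ y) :
    ∃ φ : Γ →* Multiplicative E, φ ≠ 1 := by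
  classical
  have hbot : (𝓕 ⊓ Filter.principal {y | ∃ s ∈ S, f s y ≠ y}).NeBot :=
    Filter.inf_principal_neBot_iff.2 fun V hV => by
      obtain ⟨y, hy, hyV⟩ := (hne.and_eventually hV).exists
      exact ⟨y, hyV, hy⟩
  -- Restricting to points moved by some generator makes the normalising factor `N` nonzero.
  let U : Ultrafilter E := Ultrafilter.of (𝓕 ⊓ Filter.principal {y | ∃ s ∈ S, f s y ≠ y})
  have hU : (U : Filter E) ≤ 𝓕 := (Ultrafilter.of_le _).trans inf_le_left
  let N : E → ℝ := fun y => ∑ s ∈ S, ‖f s y - y‖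
  have hNpos : ∀ᶠ y in (U : Filter E), 0 < N y := by
    have : ∀ᶠ y in (U : Filter E), ∃ s ∈ S, f s y ≠ y :=
      (Ultrafilter.of_le _).trans inf_le_right (Filter.mem_principal_self _)
    filter_upwards [this] with y hy
    obtain ⟨s, hs, hsy⟩ := hy
    exact Finset.sum_pos' (fun _ _ => norm_nonneg _) ⟨s, hs, norm_pos_iff.2 (sub_ne_zero.2 hsy)⟩
  have hlip' : ∀ γ δ, ∀ K : ℝ, 0 < K → ∀ᶠ y in (U : Filter E),
      ‖(f γ (f δ y) - f δ y) - (f γ y - y)‖ ≤ K * ‖f δ y - y‖ := by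
    intro γ δ K hK
    obtain ⟨t, ht, hlt⟩ := hlip γ ⟨K, hK.le⟩ hK
    filter_upwards [hU ht, hU (htendsto δ ht)] with y hy hy'
    have := hlt.dist_le_mul _ hy' _ hy
    rwa [dist_eq_norm, dist_eq_norm] at this
  have hbound : ∀ γ, ∃ C : ℝ, 0 < C ∧ ∀ᶠ y in (U : Filter E), ‖f γ y - y‖ ≤ C * N y := by
    intro γ
    have hγ : γ ∈ Subgroup.closure (S : Set Γ) := hS ▸ Subgroup.mem_top γ
    induction hγ using Subgroup.closure_induction with
    | mem s hs =>
      refine ⟨1, one_pos, Filter.Eventually.of_forall fun y => ?_⟩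
      rw [one_mul]
      exact Finset.single_le_sum (f := fun s => ‖f s y - y‖) (fun _ _ => norm_nonneg _) hs
    | one =>
      refine ⟨1, one_pos, ?_⟩
      filter_upwards [hU hone, hNpos] with y hy hN
      rw [hy, sub_self, norm_zero]; linarith
    | mul γ δ _ _ h1 h2 =>
      obtain ⟨C, hC, h1⟩ := h1
      obtain ⟨D, hD, h2⟩ := h2
      -- The displacement of a product is the sum of the two displacements plus an error, which the
      -- Lipschitz constant 1 bounds by the displacement of `δ`; this accounts for the second `D`.
      refine ⟨C + 2 * D, by positivity, ?_⟩
      filter_upwards [h1, h2, hU (hmul γ δ), hlip' γ δ 1 one_pos] with y h1 h2 h3 h4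
      rw [h3]
      have : f γ (f δ y) - y =
          ((f γ (f δ y) - f δ y) - (f γ y - y)) + (f γ y - y) + (f δ y - y) := by
        abel
      rw [this]
      refine (norm_add₃_le).trans ?_
      linarith
    | inv γ _ h1 =>
      obtain ⟨C, hC, h1⟩ := h1
      refine ⟨2 * C, by positivity, ?_⟩
      filter_upwards [h1, hU (hmul γ⁻¹ γ), hU hone, hlip' γ⁻¹ γ 1 one_pos] with y h1 h2 h3 h4
      rw [inv_mul_cancel, h3] at h2
      rw [← h2] at h4
      have : f γ⁻¹ y - y = -((y - f γ y) - (f γ⁻¹ y - y)) - (f γ y - y) := by abel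
      rw [this]
      refine (norm_sub_le _ _).trans ?_
      rw [norm_neg]
      linarith
  have hlim : ∀ γ, ∃ a : E, Filter.Tendsto (fun y => (N y)⁻¹ • (f γ y - y)) U (𝓝 a) := by
    intro γ
    obtain ⟨C, hC, hγ⟩ := hbound γ
    obtain ⟨a, _, ha⟩ := (isCompact_closedBall (0 : E) C).ultrafilter_le_nhds
      (U.map fun y => (N y)⁻¹ • (f γ y - y)) (by
        rw [Filter.le_principal_iff]
        show ∀ᶠ y in (U : Filter E), (N y)⁻¹ • (f γ y - y) ∈ Metric.closedBall 0 C
        filter_upwards [hγ, hNpos] with y h1 h2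
        rw [mem_closedBall_zero_iff, norm_smul, norm_inv, Real.norm_of_nonneg h2.le,
          inv_mul_le_iff₀ h2, mul_comm]
        exact h1)
    exact ⟨a, ha⟩
  choose φ hφ using hlim
  have hadd : ∀ γ δ, φ (γ * δ) = φ γ + φ δ := by
    intro γ δ
    -- The failure of additivity is negligible against `N`, because the Lipschitz constant can be
    -- taken as small as desired.
    have hzero : Filter.Tendsto (fun y => (N y)⁻¹ • ((f γ (f δ y) - f δ y) - (f γ y - y))) U
        (𝓝 0) := by
      obtain ⟨C, hC, hδ⟩ := hbound δ
      rw [Metric.tendsto_nhds]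
      intro ε hε
      filter_upwards [hlip' γ δ (ε / (2 * C)) (by positivity), hδ, hNpos] with y h1 h2 h3
      rw [dist_zero_right, norm_smul, norm_inv, Real.norm_of_nonneg h3.le, inv_mul_lt_iff₀ h3]
      calc _ ≤ ε / (2 * C) * (C * N y) := h1.trans (by gcongr)
        _ = ε / 2 * N y := by field_simp
        _ < N y * ε := by nlinarith
    have hsum := (hzero.add (hφ γ)).add (hφ δ)
    rw [zero_add] at hsum
    refine tendsto_nhds_unique ((hφ (γ * δ)).congr' ?_) hsum
    filter_upwards [hU (hmul γ δ)] with y hy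
    rw [hy, ← smul_add, ← smul_add]
    congr 1
    abel
  refine ⟨MonoidHom.mk' (fun γ => Multiplicative.ofAdd (φ γ)) fun γ δ =>
    congrArg Multiplicative.ofAdd (hadd γ δ), fun h => ?_⟩
  have hφ0 : ∀ γ, φ γ = 0 := fun γ => congrArg Multiplicative.toAdd (DFunLike.congr_fun h γ)
  -- By the choice of `N` these sums equal 1 eventually, so the limit cannot vanish on all
  -- generators.
  have hsum : Filter.Tendsto (fun y => ∑ s ∈ S, ‖(N y)⁻¹ • (f s y - y)‖) U (𝓝 (∑ s ∈ S, ‖φ s‖)) :=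
    tendsto_finsetSum _ fun s _ => (hφ s).norm
  simp only [hφ0, norm_zero, Finset.sum_const_zero] at hsum
  have : Filter.Tendsto (fun _ => (1 : ℝ)) (U : Filter E) (𝓝 0) := by
    refine hsum.congr' ?_
    filter_upwards [hNpos] with y hy
    simp only [norm_smul, ← Finset.mul_sum, norm_inv, Real.norm_of_nonneg hy.le]
    exact inv_mul_cancel₀ hy.ne'
  exact one_ne_zero (tendsto_nhds_unique tendsto_const_nhds this)

/-- A `C¹` function on a convex set whose derivative vanishes at a point has arbitrarily small
Lipschitz constants near that point. -/
theorem ContDiffWithinAt.exists_lipschitzOnWith_of_fderivWithin_eq_zero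
    {F : Type*} [NormedAddCommGroup F] [NormedSpace ℝ F] {f : E → F} {s : Set E} {x : E}
    (hf : ContDiffWithinAt ℝ 1 f s x) (hs : Convex ℝ s) (hu : UniqueDiffOn ℝ s) (hx : x ∈ s)
    (h0 : fderivWithin ℝ f s x = 0) (K : NNReal) (hK : 0 < K) :
    ∃ t ∈ 𝓝[s] x, LipschitzOnWith K f t := by
  obtain ⟨t, hst, p, hp⟩ := hf 1 le_rfl
  rw [Set.insert_eq_of_mem hx] at hst
  obtain ⟨ε, ε0, hε⟩ := Metric.mem_nhdsWithin_iff.mp hst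
  have hxs : x ∈ Metric.ball x ε ∩ s := ⟨Metric.mem_ball_self ε0, hx⟩
  replace hp : HasFTaylorSeriesUpToOn 1 f p (insert x (Metric.ball x ε ∩ s)) := by
    rw [Set.insert_eq_of_mem hxs]
    exact hp.mono hε
  have hd := hp.hasFDerivWithinAt one_ne_zero (Set.mem_insert _ _)
  rw [Set.insert_eq_of_mem hxs, Set.inter_comm] at hd
  have hd' := (hasFDerivWithinAt_inter (Metric.ball_mem_nhds x ε0)).1 hd
  -- Unique differentiability identifies the first Taylor coefficient with the vanishing derivative.
  -- Any positive constant therefore exceeds its norm, and convexity allows the mean value estimate.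
  have hp0 : p x 1 = 0 := by
    have := (hd'.fderivWithin (hu x hx)).symm.trans h0
    simpa using this
  obtain ⟨t', ht', hlt⟩ := hp.exists_lipschitzOnWith_of_nnnorm_lt
    ((convex_ball _ _).inter hs) K (by simpa [hp0] using hK)
  rw [Set.inter_comm, ← nhdsWithin_restrict' _ (Metric.ball_mem_nhds _ ε0)] at ht'
  exact ⟨t', ht', hlt⟩

variable {H : Type*} [TopologicalSpace H] {I : ModelWithCorners ℝ E H}
  {M : Type*} [TopologicalSpace M] [ChartedSpace H M]

/-- The differential of a map at a fixed point, read in the chart at that point. -/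
theorem mfderiv_eq_fderivWithin_of_fixed {g : M → M} {k : M} (hg : MDifferentiableAt I I g k)
    (hk : g k = k) :
    (mfderiv I I g k : E →L[ℝ] E) = fderivWithin ℝ (extChartAt I k ∘ g ∘ (extChartAt I k).symm)
      (Set.range I) (extChartAt I k k) := by
  refine hg.mfderiv.trans ?_
  unfold writtenInExtChartAt
  rw [hk]

/-- The fixed point set of a group of diffeomorphisms of a connected manifold is everything, or it
has a point in the frontier of its interior, where all differentials are the identity. -/
theorem exists_chart_fderivWithin_eq_id [T2Space M] [ConnectedSpace M] [IsManifold I 1 M]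
    {Γ : Type*} [Group Γ]
    (a : Γ →* (M ≃ₘ^1⟮I, I⟯ M)) (hne : ∃ γ x, a γ x ≠ x) (k : M)
    (hk : ∀ γ, a γ k = k)
    (hd : ∀ γ, (mfderiv I I (a γ) k : E →L[ℝ] E) = ContinuousLinearMap.id ℝ E) :
    ∃ q : M, (∀ γ, a γ q = q) ∧ q ∉ interior {x | ∀ γ, a γ x = x} ∧
      ∀ γ, fderivWithin ℝ (extChartAt I q ∘ a γ ∘ (extChartAt I q).symm) (Set.range I)
        (extChartAt I q q) = ContinuousLinearMap.id ℝ E := by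
  have hclosed : IsClosed {x | ∀ γ, a γ x = x} := by
    simp only [Set.ofPred_forall]
    exact isClosed_iInter fun γ => isClosed_eq (a γ).continuous continuous_id
  -- If the fixed set has empty interior, `k` itself serves. Otherwise this interior is open,
  -- nonempty and proper, so it is not closed, and any further point of its closure serves.
  by_cases hW : interior {x | ∀ γ, a γ x = x} = ∅
  · refine ⟨k, hk, by simp [hW], fun γ => ?_⟩
    exact (mfderiv_eq_fderivWithin_of_fixed ((a γ).mdifferentiable one_ne_zero k)
      (hk γ)).symm.trans (hd γ)
  · have hWuniv : interior {x | ∀ γ, a γ x = x} ≠ Set.univ := by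
      obtain ⟨γ, x, hx⟩ := hne
      intro h
      exact hx (interior_subset (h ▸ Set.mem_univ x : x ∈ interior {x | ∀ γ, a γ x = x}) γ)
    have hnc : ¬ IsClosed (interior {x | ∀ γ, a γ x = x}) := fun h => by
      rcases isClopen_iff.1 ⟨h, isOpen_interior⟩ with h | h
      exacts [hW h, hWuniv h]
    obtain ⟨q, hq, hq'⟩ : ∃ q ∈ closure (interior {x | ∀ γ, a γ x = x}),
        q ∉ interior {x | ∀ γ, a γ x = x} := by
      by_contra! h
      exact hnc (isClosed_of_closure_subset h)
    have hqfix : ∀ γ, a γ q = q := hclosed.closure_subset_iff.2 interior_subset hq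
    refine ⟨q, hqfix, hq', fun γ => ?_⟩
    have hcd := (contMDiffAt_iff.1 ((a γ).contMDiff q)).2
    rw [hqfix γ] at hcd
    have hcont := (hcd.fderivWithin_right (m := 0) I.uniqueDiffOn le_rfl
      (extChartAt_target_subset_range q (mem_extChartAt_target (I := I) q))).continuousWithinAt
    have htend : Filter.Tendsto (fun x => fderivWithin ℝ
        (extChartAt I q ∘ a γ ∘ (extChartAt I q).symm) (Set.range I) (extChartAt I q x)) (𝓝 q)
        (𝓝 (fderivWithin ℝ (extChartAt I q ∘ a γ ∘ (extChartAt I q).symm) (Set.range I)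
          (extChartAt I q q))) := by
      refine Filter.Tendsto.comp hcont ?_
      rw [← map_extChartAt_nhds]
      exact Filter.tendsto_map
    have hfreq : ∃ᶠ x in 𝓝 q, x ∈ interior {x | ∀ γ, a γ x = x} ∩ (extChartAt I q).source :=
      (mem_closure_iff_frequently.1 hq).and_eventually (extChartAt_source_mem_nhds q)
    have hid : ∃ᶠ x in 𝓝 q, fderivWithin ℝ
        (extChartAt I q ∘ a γ ∘ (extChartAt I q).symm) (Set.range I) (extChartAt I q x) =
        ContinuousLinearMap.id ℝ E := by
      refine hfreq.mono fun x hx => ?_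
      have hxr : extChartAt I q x ∈ Set.range I := extChartAt_target_subset_range q
        ((extChartAt I q).map_source hx.2)
      have : (extChartAt I q ∘ a γ ∘ (extChartAt I q).symm) =ᶠ[𝓝[Set.range I] (extChartAt I q x)]
          id := by
        rw [← map_extChartAt_nhds' hx.2, Filter.EventuallyEq, Filter.eventually_map]
        filter_upwards [isOpen_interior.mem_nhds hx.1,
          (isOpen_extChartAt_source q).mem_nhds hx.2] with y hy hy'
        simp only [Function.comp_apply, (extChartAt I q).left_inv hy', id]
        rw [interior_subset hy γ]
      rw [this.fderivWithin_eq_of_mem hxr]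
      exact fderivWithin_id (I.uniqueDiffOn _ hxr)
    exact isClosed_singleton.mem_of_frequently_of_tendsto hid htend

/-- Thurston's stability theorem: a finitely generated nontrivial group of `C¹` diffeomorphisms of
a connected manifold that fix a point and have trivial differential there surjects onto `ℤ`. -/
theorem exists_surjective_int_of_mfderiv_eq_id [FiniteDimensional ℝ E] [T2Space M]
    [ConnectedSpace M] [IsManifold I 1 M]
    {Γ : Type*} [Group Γ] [Group.FG Γ] (a : Γ →* (M ≃ₘ^1⟮I, I⟯ M)) (hne : ∃ γ x, a γ x ≠ x) (k : M)
    (hk : ∀ γ, a γ k = k)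
    (hd : ∀ γ, (mfderiv I I (a γ) k : E →L[ℝ] E) = ContinuousLinearMap.id ℝ E) :
    ∃ f : Γ →* Multiplicative ℤ, Function.Surjective f := by
  obtain ⟨q, hq, hqi, hqd⟩ := exists_chart_fderivWithin_eq_id a hne k hk hd
  obtain ⟨S, hS⟩ := Group.fg_def.1 (inferInstance : Group.FG Γ)
  have hmap : ∀ γ δ x, a (γ * δ) x = a γ (a δ x) := fun γ δ x => by rw [map_mul]; rfl
  have hone : ∀ x, a 1 x = x := fun x => by rw [map_one]; rfl
  have hat : ∀ γ, Filter.Tendsto (a γ) (𝓝 q) (𝓝 q) := fun γ => by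
    have := (a γ).continuous.tendsto q
    rwa [hq γ] at this
  have hsrc : ∀ᶠ x in 𝓝 q, x ∈ (extChartAt I q).source := extChartAt_source_mem_nhds (I := I) q
  suffices h : ∃ φ : Γ →* Multiplicative E, φ ≠ 1 by
    obtain ⟨φ, hφ⟩ := h
    exact exists_surjective_int_of_ne_one φ hφ
  refine exists_hom_ne_one_of_lipschitz_displacement S hS
    (𝓝[Set.range I] (extChartAt I q q))
    (fun γ => extChartAt I q ∘ a γ ∘ (extChartAt I q).symm) ?_ ?_ ?_ ?_ ?_
  · rw [← map_extChartAt_nhds, Filter.eventually_map]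
    filter_upwards [hsrc] with x hx
    simp only [Function.comp_apply, hone, (extChartAt I q).left_inv hx]
  · intro γ δ
    rw [← map_extChartAt_nhds, Filter.eventually_map]
    filter_upwards [hsrc, (hat δ).eventually hsrc] with x hx hx'
    simp only [Function.comp_apply, hmap, (extChartAt I q).left_inv hx,
      (extChartAt I q).left_inv hx']
  · intro γ
    rw [← map_extChartAt_nhds, Filter.tendsto_map'_iff]
    refine Filter.Tendsto.congr' ?_ (Filter.tendsto_map.comp (hat γ))
    filter_upwards [hsrc] with x hx
    simp only [Function.comp_apply, (extChartAt I q).left_inv hx]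
  · intro γ K hK
    have hcd := (contMDiffAt_iff.1 ((a γ).contMDiff q)).2
    rw [hq γ] at hcd
    have hmem := extChartAt_target_subset_range q (mem_extChartAt_target (I := I) q)
    refine (hcd.sub contDiffWithinAt_id).exists_lipschitzOnWith_of_fderivWithin_eq_zero
      I.convex_range I.uniqueDiffOn hmem ?_ K hK
    have := fderivWithin_sub (I.uniqueDiffOn _ hmem) (hcd.differentiableWithinAt one_ne_zero)
      (differentiableWithinAt_id (𝕜 := ℝ))
    exact this.trans (by rw [hqd γ, fderivWithin_id (I.uniqueDiffOn _ hmem), sub_self])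
  · rw [← map_extChartAt_nhds, Filter.frequently_map]
    -- Moved points accumulate at `q` because `q` is not interior to the fixed set. Each is moved by
    -- some generator, and the chart detects this once the images under `S` stay in its source.
    have hfreq : ∃ᶠ x in 𝓝 q, ¬ ∀ γ, a γ x = x := by
      rw [mem_interior_iff_mem_nhds] at hqi
      exact fun h => hqi (h.mono fun x hx => not_not.1 hx)
    have hsrcS : ∀ᶠ x in 𝓝 q, x ∈ (extChartAt I q).source ∧
        ∀ s ∈ S, a s x ∈ (extChartAt I q).source :=
      hsrc.and ((Filter.eventually_all_finset S).2 fun s _ => (hat s).eventually hsrc)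
    refine (hfreq.and_eventually hsrcS).mono fun x ⟨hx, hx1, hx2⟩ => ?_
    by_contra! hcon
    refine hx fun γ => ?_
    have hγ : γ ∈ Subgroup.closure (S : Set Γ) := hS ▸ Subgroup.mem_top γ
    induction hγ using Subgroup.closure_induction with
    | mem s hs =>
      have := hcon s hs
      simp only [Function.comp_apply, (extChartAt I q).left_inv hx1] at this
      exact (extChartAt I q).injOn (hx2 s hs) hx1 this
    | one => exact hone x
    | mul γ δ _ _ h1 h2 => rw [hmap, h2, h1]
    | inv γ _ h1 =>
      calc a γ⁻¹ x = a γ⁻¹ (a γ x) := by rw [h1]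
        _ = x := by rw [← hmap, inv_mul_cancel, hone]

end Thurston

/-! ### Block matrices of maps fixing a subspace of codimension two -/

section LinearAlgebra

variable {E : Type*} [AddCommGroup E] [Module ℝ E] {d : ℕ}

/-- Linear coordinates in which the range of an injective linear map is a coordinate subspace. -/
theorem exists_coordinates_range [FiniteDimensional ℝ E] (hE : finrank ℝ E = d + 2) {E' : Type*}
    [AddCommGroup E'] [Module ℝ E'] (hE' : finrank ℝ E' = d) (D : E' →ₗ[ℝ] E)
    (hD : Function.Injective D) :
    ∃ b : E ≃ₗ[ℝ] (Fin d → ℝ) × (Fin 2 → ℝ), ∀ v, v ∈ Set.range D ↔ (b v).2 = 0 := by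
  obtain ⟨Q, hQ⟩ := (LinearMap.range D).exists_isCompl
  have hR : finrank ℝ (LinearMap.range D) = d := (LinearMap.finrank_range_of_inj hD).trans hE'
  have hQ2 : finrank ℝ Q = 2 := by
    have := Submodule.finrank_add_eq_of_isCompl hQ
    omega
  let e₁ : LinearMap.range D ≃ₗ[ℝ] (Fin d → ℝ) := LinearEquiv.ofFinrankEq _ _ (by simpa using hR)
  let e₂ : Q ≃ₗ[ℝ] (Fin 2 → ℝ) := LinearEquiv.ofFinrankEq _ _ (by simpa using hQ2)
  refine ⟨(Submodule.prodEquivOfIsCompl _ _ hQ).symm.trans (e₁.prodCongr e₂), fun v => ?_⟩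
  rw [← LinearMap.coe_range, SetLike.mem_coe]
  have : (((Submodule.prodEquivOfIsCompl _ _ hQ).symm.trans (e₁.prodCongr e₂)) v).2 =
    e₂ ((Submodule.prodEquivOfIsCompl _ _ hQ).symm v).2 := rfl
  rw [this, e₂.map_eq_zero_iff, Submodule.prodEquivOfIsCompl_symm_apply_snd_eq_zero]

theorem knotLinearAct_injective :
    Function.Injective (knotLinearAct : KnotLinearGroup d → _ → _) := by
  intro p q h
  have hr : p.right = q.right := glMatrix_injective <| Matrix.ext_of_mulVec_single fun i => by
    have := congrArg Prod.snd (congrFun h (0, Pi.single i 1))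
    simpa [knotLinearAct] using this
  have hl : Multiplicative.toAdd p.left * glMatrix p.right =
      Multiplicative.toAdd q.left * glMatrix q.right := Matrix.ext_of_mulVec_single fun i => by
    have := congrArg Prod.fst (congrFun h (0, Pi.single i 1))
    simpa [knotLinearAct] using this
  refine SemidirectProduct.ext ?_ hr
  rw [hr] at hl
  have := congrArg (· * glMatrix q.right⁻¹) hl
  simp only [Matrix.mul_assoc, glMatrix_mul_inv, Matrix.mul_one] at this
  exact Multiplicative.toAdd.injective this

theorem knotLinearAct_one (v : (Fin d → ℝ) × (Fin 2 → ℝ)) :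
    knotLinearAct (1 : KnotLinearGroup d) v = v := by
  simp [knotLinearAct]

/-- The element of `ℝ^{2d} ⋊ GL⁺(2, ℝ)` with given block matrix. -/
noncomputable def knotOfBlocks (B : Matrix (Fin d) (Fin 2) ℝ) (A : Matrix (Fin 2) (Fin 2) ℝ)
    (hA : 0 < A.det) : KnotLinearGroup d :=
  ⟨Multiplicative.ofAdd (B * glMatrix (glOfMatrix A hA)⁻¹), glOfMatrix A hA⟩

theorem knotLinearAct_knotOfBlocks (B : Matrix (Fin d) (Fin 2) ℝ) (A : Matrix (Fin 2) (Fin 2) ℝ)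
    (hA : 0 < A.det) (v : (Fin d → ℝ) × (Fin 2 → ℝ)) :
    knotLinearAct (knotOfBlocks B A hA) v = (v.1 + B *ᵥ v.2, A *ᵥ v.2) := by
  have : Multiplicative.toAdd (knotOfBlocks B A hA).left * glMatrix (knotOfBlocks B A hA).right =
      B := by
    show B * glMatrix (glOfMatrix A hA)⁻¹ * glMatrix (glOfMatrix A hA) = B
    rw [Matrix.mul_assoc, glMatrix_inv_mul, Matrix.mul_one]
  unfold knotLinearAct
  rw [this]
  rfl

/-- A linear map with positive determinant that fixes a coordinate subspace of codimension two
pointwise is given by an element of `ℝ^{2d} ⋊ GL⁺(2, ℝ)`. -/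
theorem exists_knotLinearAct_eq (b : E ≃ₗ[ℝ] (Fin d → ℝ) × (Fin 2 → ℝ)) (L : E →ₗ[ℝ] E)
    (hL : ∀ v, (b v).2 = 0 → L v = v) (hdet : 0 < LinearMap.det L) :
    ∃ p : KnotLinearGroup d, ∀ v, b (L v) = knotLinearAct p (b v) := by
  let T : (Fin d → ℝ) × (Fin 2 → ℝ) →ₗ[ℝ] (Fin d → ℝ) × (Fin 2 → ℝ) :=
    (b : E →ₗ[ℝ] _) ∘ₗ L ∘ₗ (b.symm : _ →ₗ[ℝ] E)
  have hT : ∀ v, T (b v) = b (L v) := fun v => by simp [T]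
  have hT1 : ∀ y, T (y, 0) = (y, 0) := fun y => by
    have := hL (b.symm (y, 0)) (by simp)
    simp [T, this]
  let B := LinearMap.toMatrix' (LinearMap.fst ℝ _ _ ∘ₗ T ∘ₗ LinearMap.inr ℝ (Fin d → ℝ) (Fin 2 → ℝ))
  let A := LinearMap.toMatrix' (LinearMap.snd ℝ _ _ ∘ₗ T ∘ₗ LinearMap.inr ℝ (Fin d → ℝ) (Fin 2 → ℝ))
  have hB : ∀ w, B *ᵥ w = (T (0, w)).1 := fun w => by
    simp only [B, LinearMap.toMatrix'_mulVec]; rfl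
  have hA : ∀ w, A *ᵥ w = (T (0, w)).2 := fun w => by
    simp only [A, LinearMap.toMatrix'_mulVec]; rfl
  have hTv : ∀ v, T v = (v.1 + B *ᵥ v.2, A *ᵥ v.2) := fun v => by
    have : v = (v.1, 0) + (0, v.2) := by simp
    conv_lhs => rw [this]
    rw [map_add, hT1, hA, hB]
    ext <;> simp
  -- In these coordinates `L` is block triangular with an identity block, so its determinant is that
  -- of `A`.
  have hdetA : 0 < A.det := by
    have h1 : LinearMap.det T = LinearMap.det L := LinearMap.det_conj L b
    let c := (Pi.basisFun ℝ (Fin d)).prod (Pi.basisFun ℝ (Fin 2))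
    have h2 : LinearMap.toMatrix c c T = Matrix.fromBlocks 1 B 0 A := by
      ext i j
      rw [LinearMap.toMatrix_apply, hTv]
      rcases i with i | i <;> rcases j with j | j <;>
        simp [c, Matrix.one_apply, Pi.single_apply, Basis.prod_repr_inl, Basis.prod_repr_inr]
    rw [← h1, ← LinearMap.det_toMatrix c, h2, Matrix.det_fromBlocks_zero₂₁, Matrix.det_one,
      one_mul] at hdet
    exact hdet
  refine ⟨knotOfBlocks B A hdetA, fun v => ?_⟩
  rw [knotLinearAct_knotOfBlocks, ← hT, hTv]

end LinearAlgebra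

/-! ### The differential at a point of K as a homomorphism with locally indicable kernel -/

section KnotHom

variable {E : Type*} [NormedAddCommGroup E] [NormedSpace ℝ E] [FiniteDimensional ℝ E]
  {H : Type*} [TopologicalSpace H] {I : ModelWithCorners ℝ E H}
  {M : Type*} [TopologicalSpace M] [ChartedSpace H M]

theorem orientation_map_eq_iff (o : Orientation ℝ E (Fin (finrank ℝ E))) (e : E ≃ₗ[ℝ] E) :
    Orientation.map _ e o = o ↔ 0 < LinearMap.det (e : E →ₗ[ℝ] E) :=
  o.map_eq_iff_det_pos e (by simp)

theorem IsOrientationPreserving.det_mfderiv_pos (hM : IsOrientableManifold I M) {g : M → M}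
    (hg : IsOrientationPreserving I g) {k : M} (hk : g k = k) :
    0 < LinearMap.det (mfderiv I I g k : E →L[ℝ] E).toLinearMap := by
  obtain ⟨o, ho⟩ := hM
  obtain ⟨e, he, he'⟩ : ∃ e : E ≃ₗ[ℝ] E,
      (e : E →ₗ[ℝ] E) = (mfderiv I I g k : E →L[ℝ] E).toLinearMap ∧
      Orientation.map _ e (o k : Orientation ℝ E (Fin (finrank ℝ E))) = o (g k) := hg o ho k
  have hok : (o (g k) : Orientation ℝ E (Fin (finrank ℝ E))) = o k :=
    congrArg (show M → Orientation ℝ E (Fin (finrank ℝ E)) from o) hk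
  rw [← he]
  exact (orientation_map_eq_iff (E := E) (o k) e).1 (he'.trans hok)

/-- The differential at a fixed point, as a homomorphism to `ℝ^{2d} ⋊ GL⁺(2, ℝ)`. -/
theorem exists_knotHom [T2Space M] [ConnectedSpace M] [IsManifold I 1 M]
    (hM : IsOrientableManifold I M) {d : ℕ} (K : Set M) (k : M) (hk : k ∈ K)
    (b : E ≃ₗ[ℝ] (Fin d → ℝ) × (Fin 2 → ℝ))
    (hfix : ∀ (g : Diff1Plus I K) (v : E), (b v).2 = 0 →
      (mfderiv I I g.1 k : E →L[ℝ] E) v = v) :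
    ∃ ρ : Diff1Plus I K →* KnotLinearGroup d,
      (∀ (g : Diff1Plus I K) (v : E),
        b ((mfderiv I I g.1 k : E →L[ℝ] E) v) = knotLinearAct (ρ g) (b v)) ∧
      IsLocallyIndicable ρ.ker := by
  choose p hp using fun g : Diff1Plus I K => exists_knotLinearAct_eq b
    (mfderiv I I g.1 k : E →L[ℝ] E).toLinearMap (hfix g)
    (IsOrientationPreserving.det_mfderiv_pos hM g.2.1 (g.2.2 k hk))
  have hmul : ∀ (g h : Diff1Plus I K) (v : E), (mfderiv I I (g * h).1 k : E →L[ℝ] E) v =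
      (mfderiv I I g.1 k : E →L[ℝ] E) ((mfderiv I I h.1 k : E →L[ℝ] E) v) := by
    intro g h v
    have hc : mfderiv I I (⇑g.1 ∘ ⇑h.1) k = (mfderiv I I g.1 (h.1 k)).comp (mfderiv I I h.1 k) :=
      mfderiv_comp k (g.1.mdifferentiable one_ne_zero _) (h.1.mdifferentiable one_ne_zero _)
    have hgk : (mfderiv I I g.1 (h.1 k) : E →L[ℝ] E) = mfderiv I I g.1 k :=
      congrArg (β := E →L[ℝ] E) (fun y => mfderiv I I g.1 y) (h.2.2 k hk)
    have hc' : (mfderiv I I (g * h).1 k : E →L[ℝ] E) =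
      (mfderiv I I g.1 (h.1 k) : E →L[ℝ] E).comp (mfderiv I I h.1 k : E →L[ℝ] E) := hc
    rw [hc', hgk]
    rfl
  let ρ : Diff1Plus I K →* KnotLinearGroup d := MonoidHom.mk' p fun g h =>
    knotLinearAct_injective <| funext fun v => by
      obtain ⟨v, rfl⟩ := b.surjective v
      rw [knotLinearAct_mul]
      have h1 : b ((mfderiv I I (g * h).1 k : E →L[ℝ] E) v) = _ := hp (g * h) v
      have h2 : b ((mfderiv I I g.1 k : E →L[ℝ] E) _) = _ :=
        hp g ((mfderiv I I h.1 k : E →L[ℝ] E) v)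
      have h3 : b ((mfderiv I I h.1 k : E →L[ℝ] E) v) = _ := hp h v
      rw [← h1, ← h3, ← h2, hmul]
  refine ⟨ρ, fun g v => hp g v, fun Γ hΓ hne => ?_⟩
  have : Group.FG Γ := (Group.fg_iff_subgroup_fg Γ).2 hΓ
  refine exists_surjective_int_of_mfderiv_eq_id
    (((Diff1Plus I K).subtype.comp ρ.ker.subtype).comp Γ.subtype) ?_ k
    (fun γ => γ.1.1.2.2 k hk) fun γ => ContinuousLinearMap.ext fun v => b.injective ?_
  · by_contra! h
    refine hne ((Subgroup.eq_bot_iff_forall _).2 fun γ hγ => ?_)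
    exact Subtype.ext (Subtype.ext (Diffeomorph.ext fun x => h ⟨γ, hγ⟩ x))
  · have h1 := hp γ.1.1 v
    have h2 : p γ.1.1 = 1 := γ.1.2
    rw [h2, knotLinearAct_one] at h1
    exact h1

end KnotHom

/-! ### A neighbourhood of the identity generates the linear group -/

section Generation

variable {d : ℕ}

theorem knotOfBlocks_mul (B B' : Matrix (Fin d) (Fin 2) ℝ) (A A' : Matrix (Fin 2) (Fin 2) ℝ)
    (hA : 0 < A.det) (hA' : 0 < A'.det) (hAA' : 0 < (A * A').det) :
    knotOfBlocks B A hA * knotOfBlocks B' A' hA' = knotOfBlocks (B' + B * A') (A * A') hAA' := by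
  refine knotLinearAct_injective (funext fun v => ?_)
  rw [knotLinearAct_mul, knotLinearAct_knotOfBlocks, knotLinearAct_knotOfBlocks,
    knotLinearAct_knotOfBlocks]
  simp only [Matrix.add_mulVec, Matrix.mulVec_mulVec, add_assoc]

theorem knotOfBlocks_eq (p : KnotLinearGroup d) :
    knotOfBlocks (Multiplicative.toAdd p.left * glMatrix p.right) (glMatrix p.right)
      (glMatrix_det_pos p.right) = p := by
  refine knotLinearAct_injective (funext fun v => ?_)
  rw [knotLinearAct_knotOfBlocks]
  rfl

/-- A subgroup that contains a neighbourhood of the identity contains every one-parameter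
subgroup. -/
theorem knotOfBlocks_mem_of_oneParameter (R : Subgroup (KnotLinearGroup d))
    (hR : ∀ᶠ q : Matrix (Fin d) (Fin 2) ℝ × Matrix (Fin 2) (Fin 2) ℝ in 𝓝 (0, 1),
      ∀ h, knotOfBlocks q.1 q.2 h ∈ R)
    (B : ℝ → Matrix (Fin d) (Fin 2) ℝ) (A : ℝ → Matrix (Fin 2) (Fin 2) ℝ)
    (hBc : Continuous B) (hAc : Continuous A) (hB0 : B 0 = 0) (hA0 : A 0 = 1)
    (hdet : ∀ t, 0 < (A t).det) (hA : ∀ s t, A (s + t) = A s * A t)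
    (hB : ∀ s t, B (s + t) = B t + B s * A t) (t : ℝ) :
    knotOfBlocks (B t) (A t) (hdet t) ∈ R := by
  let γ : Multiplicative ℝ →* KnotLinearGroup d :=
    MonoidHom.mk' (fun s => knotOfBlocks (B s.toAdd) (A s.toAdd) (hdet _)) fun s u => by
      rw [knotOfBlocks_mul _ _ _ _ _ _ (by rw [← hA]; exact hdet _)]
      simp only [toAdd_mul, hA, hB]
  have hlim : Filter.Tendsto (fun n : ℕ => (B (t / n), A (t / n))) Filter.atTop
      (𝓝 ((0, 1) : Matrix (Fin d) (Fin 2) ℝ × Matrix (Fin 2) (Fin 2) ℝ)) := by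
    have h1 := ((hBc.prodMk hAc).tendsto 0).comp (tendsto_const_div_atTop_nhds_zero_nat t)
    simpa [hB0, hA0, Function.comp_def] using h1
  obtain ⟨n, hn, hn0⟩ := ((hlim.eventually hR).and (Filter.eventually_ne_atTop 0)).exists
  have h1 : γ (Multiplicative.ofAdd (t / n)) ∈ R := hn (hdet _)
  -- For large n, the parameter t / n is sent into the neighbourhood, and the element at t is an
  -- n-th power of the element at t / n.
  have h2 : Multiplicative.ofAdd t = Multiplicative.ofAdd (t / n) ^ n := by
    rw [← ofAdd_nsmul, nsmul_eq_mul, mul_div_cancel₀ _ (Nat.cast_ne_zero.2 hn0)]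
  have h3 : γ (Multiplicative.ofAdd t) ∈ R := by
    rw [h2, map_pow]
    exact R.pow_mem h1 n
  exact h3

/-- A subgroup of `ℝ^{2d} ⋊ GL⁺(2, ℝ)` that contains a neighbourhood of the identity is
everything. -/
theorem knotLinearGroup_subgroup_eq_top (R : Subgroup (KnotLinearGroup d))
    (hR : ∀ᶠ q : Matrix (Fin d) (Fin 2) ℝ × Matrix (Fin 2) (Fin 2) ℝ in 𝓝 (0, 1),
      ∀ h, knotOfBlocks q.1 q.2 h ∈ R) : R = ⊤ := by
  have hB : ∀ B h, knotOfBlocks B 1 h ∈ R := fun B h => by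
    have := knotOfBlocks_mem_of_oneParameter R hR (fun t => t • B) (fun _ => 1) (by fun_prop)
      (by fun_prop) (by simp) rfl (by simp) (by simp) (fun s t => by simp [add_smul, add_comm]) 1
    simpa using this
  have hU : ∀ t h, knotOfBlocks 0 !![1, t; 0, 1] h ∈ R := fun t h =>
    knotOfBlocks_mem_of_oneParameter R hR (fun _ => 0) (fun t => !![1, t; 0, 1]) (by fun_prop)
      (by refine continuous_matrix fun i j => ?_
          fin_cases i <;> fin_cases j <;> simp <;> fun_prop)
      rfl Matrix.one_fin_two.symm (by simp [Matrix.det_fin_two])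
      (fun s t => by simp [add_comm]) (by simp) t
  have hL : ∀ t h, knotOfBlocks 0 !![1, 0; t, 1] h ∈ R := fun t h =>
    knotOfBlocks_mem_of_oneParameter R hR (fun _ => 0) (fun t => !![1, 0; t, 1]) (by fun_prop)
      (by refine continuous_matrix fun i j => ?_
          fin_cases i <;> fin_cases j <;> simp <;> fun_prop)
      rfl Matrix.one_fin_two.symm (by simp [Matrix.det_fin_two])
      (fun s t => by simp) (by simp) t
  have hD : ∀ δ h, knotOfBlocks 0 !![1, 0; 0, δ] h ∈ R := fun δ h => by
    have hδ : 0 < δ := by simpa [Matrix.det_fin_two] using h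
    have := knotOfBlocks_mem_of_oneParameter R hR (fun _ => 0)
      (fun t => !![1, 0; 0, Real.exp t]) (by fun_prop)
      (by refine continuous_matrix fun i j => ?_
          fin_cases i <;> fin_cases j <;> simp <;> fun_prop)
      rfl (by simp [Matrix.one_fin_two]) (by simp [Matrix.det_fin_two, Real.exp_pos])
      (fun s t => by simp [Real.exp_add]) (by simp) (Real.log δ)
    simpa [Real.exp_log hδ] using this
  have hmul : ∀ A A' : Matrix (Fin 2) (Fin 2) ℝ, 0 < A.det → (∀ h, knotOfBlocks 0 A h ∈ R) →
      0 < A'.det → (∀ h, knotOfBlocks 0 A' h ∈ R) → ∀ h, knotOfBlocks 0 (A * A') h ∈ R := by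
    intro A A' hA h1 hA' h2 h
    have := R.mul_mem (h1 hA) (h2 hA')
    rw [knotOfBlocks_mul _ _ _ _ _ _ h] at this
    simpa using this
  have hA1 : ∀ A : Matrix (Fin 2) (Fin 2) ℝ, A 1 0 ≠ 0 → ∀ h, knotOfBlocks 0 A h ∈ R := by
    intro A hc h
    have hdet : A.det ≠ 0 := h.ne'
    -- Shears adjust the other entries once the lower left entry is nonzero, and a diagonal factor
    -- carries the determinant. Each factor lies on a one-parameter subgroup.
    have key : A = !![1, (A 0 0 - 1) / A 1 0; 0, 1] * (!![1, 0; A 1 0, 1] *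
        (!![1, (A 1 1 / A.det - 1) / A 1 0; 0, 1] * !![1, 0; 0, A.det])) := by
      have hΔ := Matrix.det_fin_two A
      generalize A.det = Δ at hΔ hdet
      ext i j
      fin_cases i <;> fin_cases j <;> simp [Matrix.mul_apply, Fin.sum_univ_two] <;>
        field_simp <;> first | ring1 | linear_combination hΔ
    have d1 : ∀ t : ℝ, 0 < (!![1, t; 0, 1] : Matrix (Fin 2) (Fin 2) ℝ).det := by
      simp [Matrix.det_fin_two]
    have d2 : ∀ t : ℝ, 0 < (!![1, 0; t, 1] : Matrix (Fin 2) (Fin 2) ℝ).det := by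
      simp [Matrix.det_fin_two]
    have d3 : 0 < (!![1, 0; 0, A.det] : Matrix (Fin 2) (Fin 2) ℝ).det := by
      simpa [Matrix.det_fin_two_of] using h
    have d4 := d1 ((A 1 1 / A.det - 1) / A 1 0)
    have m1 := hmul _ _ d4 (hU _) d3 (hD _)
    have d5 : 0 < (!![1, (A 1 1 / A.det - 1) / A 1 0; 0, 1] * !![1, 0; 0, A.det]).det := by
      rw [Matrix.det_mul]; exact mul_pos d4 d3
    have m2 := hmul _ _ (d2 (A 1 0)) (hL _) d5 m1
    have d6 := mul_pos (d2 (A 1 0)) d5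
    rw [← Matrix.det_mul] at d6
    have m3 := hmul _ _ (d1 ((A 0 0 - 1) / A 1 0)) (hU _) d6 m2
    have : ∀ A' : Matrix (Fin 2) (Fin 2) ℝ, A = A' → (∀ h, knotOfBlocks 0 A' h ∈ R) →
        knotOfBlocks 0 A h ∈ R := by
      rintro _ rfl h'
      exact h' h
    exact this _ key m3
  have hA : ∀ (A : Matrix (Fin 2) (Fin 2) ℝ) h, knotOfBlocks 0 A h ∈ R := by
    intro A h
    by_cases hc : A 1 0 = 0
    · have ha : A 0 0 ≠ 0 := fun ha => by
        rw [Matrix.det_fin_two, hc, ha] at h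
        simp at h
      have d2 : 0 < (!![1, 0; 1, 1] : Matrix (Fin 2) (Fin 2) ℝ).det := by
        simp [Matrix.det_fin_two]
      have d3 := mul_pos d2 h
      rw [← Matrix.det_mul] at d3
      -- A lower shear copies the nonzero entry `A 0 0` into the lower left corner, reducing to the
      -- previous case.
      have h1 := hA1 (!![1, 0; 1, 1] * A) (by simp [Matrix.mul_apply, Fin.sum_univ_two, hc, ha]) d3
      have h2 := knotOfBlocks_mul 0 0 _ A d2 h d3 (d := d)
      simp only [Matrix.zero_mul, add_zero] at h2
      rw [← h2] at h1
      exact (R.mul_mem_cancel_left (hL _ d2)).1 h1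
    · exact hA1 A hc h
  refine (Subgroup.eq_top_iff' R).2 fun p => ?_
  have h1 := R.mul_mem (hA _ (glMatrix_det_pos p.right))
    (hB (Multiplicative.toAdd p.left * glMatrix p.right) (by simp))
  rw [knotOfBlocks_mul _ _ _ _ _ _ (by simpa using glMatrix_det_pos p.right)] at h1
  simp only [Matrix.mul_one, add_zero] at h1
  rwa [knotOfBlocks_eq] at h1

end Generation

/-! ### Small perturbations of the identity of a vector space -/

section Perturbation

variable {E : Type*} [NormedAddCommGroup E] [NormedSpace ℝ E] [FiniteDimensional ℝ E]

/-- A `C¹` perturbation of the identity with small Lipschitz constant is a `C¹` diffeomorphism. -/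
theorem exists_homeomorph_id_add (u : E → E) (hu : ContDiff ℝ 1 u) (c : NNReal) (hc : c < 1)
    (hlip : LipschitzWith c u)
    (hdet : ∀ y, 0 < (ContinuousLinearMap.id ℝ E + fderiv ℝ u y).det) :
    ∃ f : E ≃ₜ E, (∀ y, f y = y + u y) ∧ ContDiff ℝ 1 f ∧ ContDiff ℝ 1 f.symm := by
  have happ : ApproximatesLinearOn (fun y => y + u y)
      ((ContinuousLinearEquiv.refl ℝ E : E ≃L[ℝ] E) : E →L[ℝ] E) Set.univ c := by
    rw [ApproximatesLinearOn.approximatesLinearOn_iff_lipschitzOnWith]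
    have : (fun y => y + u y) -
        ⇑((ContinuousLinearEquiv.refl ℝ E : E ≃L[ℝ] E) : E →L[ℝ] E) = u := by
      ext y; simp
    rw [this]
    exact hlip.lipschitzOnWith
  have hsmall : Subsingleton E ∨
      c < ‖((ContinuousLinearEquiv.refl ℝ E).symm : E →L[ℝ] E)‖₊⁻¹ := by
    rcases subsingleton_or_nontrivial E with h | h
    · exact Or.inl h
    · right
      have : ‖((ContinuousLinearEquiv.refl ℝ E).symm : E →L[ℝ] E)‖₊ = 1 := by
        rw [ContinuousLinearEquiv.refl_symm, ContinuousLinearEquiv.coe_refl]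
        exact ContinuousLinearMap.nnnorm_id
      rwa [this, inv_one]
  let f : E ≃ₜ E := ApproximatesLinearOn.toHomeomorph _ happ hsmall
  have hf : ∀ y, f y = y + u y := fun y => rfl
  have hfc : ContDiff ℝ 1 f := contDiff_id.add hu
  refine ⟨f, hf, hfc, Homeomorph.contDiff_symm f (f₀' := fun y =>
    ContinuousLinearMap.toContinuousLinearEquivOfDetNeZero _ (hdet y).ne') (fun y => ?_) hfc⟩
  exact (hasFDerivAt_id y).add (hu.differentiable one_ne_zero y).hasFDerivAt

/-- Continuous linear maps close to the identity have positive determinant. -/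
theorem exists_forall_det_id_add_pos (E : Type*) [NormedAddCommGroup E] [NormedSpace ℝ E]
    [FiniteDimensional ℝ E] :
    ∃ δ > 0, ∀ L : E →L[ℝ] E, ‖L‖ < δ → 0 < (ContinuousLinearMap.id ℝ E + L).det := by
  have hc : Continuous fun L : E →L[ℝ] E => (ContinuousLinearMap.id ℝ E + L).det :=
    ContinuousLinearMap.continuous_det.comp (continuous_const.add continuous_id)
  have h0 : 0 < (ContinuousLinearMap.id ℝ E + (0 : E →L[ℝ] E)).det := by
    rw [add_zero, ContinuousLinearMap.det, ContinuousLinearMap.coe_id, LinearMap.det_id]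
    exact one_pos
  obtain ⟨δ, hδ, h⟩ := Metric.eventually_nhds_iff.1 ((hc.tendsto 0).eventually (lt_mem_nhds h0))
  exact ⟨δ, hδ, fun L hL => h (by simpa [dist_zero_right] using hL)⟩

/-- If `ζ` is `C¹` with compact support and `S` is a small linear map, then `id + S ∘ ζ` is a `C¹`
diffeomorphism whose differentials have positive determinant. -/
theorem exists_homeomorph_id_add_comp {V : Type*} [NormedAddCommGroup V] [NormedSpace ℝ V]
    (ζ : E → V) (hζ : ContDiff ℝ 1 ζ) (hsupp : HasCompactSupport ζ) :
    ∃ ε > 0, ∀ S : V →L[ℝ] E, ‖S‖ < ε → ∃ f : E ≃ₜ E, (∀ y, f y = y + S (ζ y)) ∧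
      ContDiff ℝ 1 f ∧ ContDiff ℝ 1 f.symm ∧ ∀ y, 0 < (fderiv ℝ f y).det := by
  obtain ⟨C, hC⟩ := hζ.lipschitzWith_of_hasCompactSupport hsupp one_ne_zero
  obtain ⟨δ, hδ, hdet⟩ := exists_forall_det_id_add_pos E
  -- The bound 1 makes the perturbation a contraction, `δ` keeps determinants positive, and `C + 1`
  -- avoids division by zero.
  refine ⟨min 1 δ / (C + 1), by positivity, fun S hS => ?_⟩
  rw [lt_div_iff₀ (by positivity)] at hS
  have hSC : ‖S‖ * C < min 1 δ := by nlinarith [norm_nonneg S]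
  have hlip : LipschitzWith (‖S‖₊ * C) (fun y => S (ζ y)) := S.lipschitz.comp hC
  have hu : ContDiff ℝ 1 (fun y => S (ζ y)) := S.contDiff.comp hζ
  have hpos : ∀ y, 0 < (ContinuousLinearMap.id ℝ E + fderiv ℝ (fun y => S (ζ y)) y).det := fun y =>
    hdet _ ((norm_fderiv_le_of_lipschitz ℝ hlip).trans_lt (hSC.trans_le (min_le_right _ _)))
  obtain ⟨f, hf, hfc, hfs⟩ := exists_homeomorph_id_add _ hu _
    (by rw [← NNReal.coe_lt_coe]; exact hSC.trans_le (min_le_left _ _)) hlip hpos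
  refine ⟨f, hf, hfc, hfs, fun y => ?_⟩
  have : HasFDerivAt f (ContinuousLinearMap.id ℝ E + fderiv ℝ (fun y => S (ζ y)) y) y := by
    rw [show (f : E → E) = fun y => y + S (ζ y) from funext hf]
    exact (hasFDerivAt_id y).add (hu.differentiable one_ne_zero y).hasFDerivAt
  rw [this.fderiv]
  exact hpos y

end Perturbation

/-- If `f y` left `Q` it would be a fixed point, and injectivity would give `f y = y`. -/
theorem mapsTo_of_eq_self {X : Type*} {f : X → X} (hf : Function.Injective f) {Q : Set X}
    (hfQ : ∀ y ∉ Q, f y = y) {y : X} (hy : y ∈ Q) : f y ∈ Q := by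
  by_contra h
  have : f y = y := hf (hfQ _ h)
  exact h (this.symm ▸ hy)

/-! ### Extending compactly supported diffeomorphisms of a chart to the manifold -/

section ChartExtension

variable {E : Type*} [NormedAddCommGroup E] [NormedSpace ℝ E]
  {H : Type*} [TopologicalSpace H] {I : ModelWithCorners ℝ E H}
  {M : Type*} [TopologicalSpace M] [ChartedSpace H M]

variable (I) in
open Classical in
/-- The map that is `f` in the chart at `k` and the identity outside of that chart. -/
noncomputable def chartExtension (k : M) (f : E → E) (m : M) : M :=
  if m ∈ (extChartAt I k).source then (extChartAt I k).symm (f (extChartAt I k m)) else m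

theorem chartExtension_of_mem {k m : M} (f : E → E) (hm : m ∈ (extChartAt I k).source) :
    chartExtension I k f m = (extChartAt I k).symm (f (extChartAt I k m)) := if_pos hm

theorem chartExtension_of_notMem {k m : M} {f : E → E} {Q : Set E}
    (hfQ : ∀ y ∉ Q, f y = y) (hm : m ∉ (extChartAt I k).symm '' Q) :
    chartExtension I k f m = m := by
  unfold chartExtension
  split_ifs with h
  · rw [hfQ _ fun hQ => hm ⟨_, hQ, (extChartAt I k).left_inv h⟩, (extChartAt I k).left_inv h]
  · rfl

theorem isClosed_extChartAt_symm_image [T2Space M] {k : M} {Q : Set E} (hQ : IsCompact Q)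
    (hQt : Q ⊆ (extChartAt I k).target) : IsClosed ((extChartAt I k).symm '' Q) :=
  (hQ.image_of_continuousOn ((continuousOn_extChartAt_symm k).mono hQt)).isClosed

theorem mem_target_of_eq_self {f : E → E} (hf : Function.Injective f) {k : M} {Q : Set E}
    (hQt : Q ⊆ (extChartAt I k).target) (hfQ : ∀ y ∉ Q, f y = y) {y : E}
    (hy : y ∈ (extChartAt I k).target) : f y ∈ (extChartAt I k).target := by
  by_cases hyQ : y ∈ Q
  · exact hQt (mapsTo_of_eq_self hf hfQ hyQ)
  · rwa [hfQ y hyQ]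

/-- The chart source and the complement of the image of `Q` form an open cover; the latter is open
because a compact subset of a Hausdorff space is closed. The map is a chart conjugate of `f` on the
first set and the identity on the second. -/
theorem contMDiff_chartExtension [T2Space M] [IsManifold I 1 M] {f : E → E}
    (hf : Function.Injective f) (hfc : ContDiff ℝ 1 f) {k : M} {Q : Set E} (hQ : IsCompact Q)
    (hQt : Q ⊆ (extChartAt I k).target) (hfQ : ∀ y ∉ Q, f y = y) :
    ContMDiff I I 1 (chartExtension I k f) := by
  intro m
  by_cases hm : m ∈ (extChartAt I k).source
  · have h1 : ContMDiffOn I I 1 ((extChartAt I k).symm ∘ f ∘ extChartAt I k)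
        (extChartAt I k).source := by
      refine (contMDiffOn_extChartAt_symm k).comp
        (hfc.contMDiff.comp_contMDiffOn (extChartAt_source I k ▸ contMDiffOn_extChartAt)) ?_
      exact fun x hx => mem_target_of_eq_self hf hQt hfQ ((extChartAt I k).map_source hx)
    have hnhds := (isOpen_extChartAt_source (I := I) k).mem_nhds hm
    refine (h1.contMDiffAt hnhds).congr_of_eventuallyEq ?_
    filter_upwards [hnhds] with x hx using chartExtension_of_mem f hx
  · have hm' : m ∈ ((extChartAt I k).symm '' Q)ᶜ := by
      rintro ⟨y, hy, rfl⟩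
      exact hm ((extChartAt I k).map_target (hQt hy))
    have : ContMDiffAt I I 1 (fun x : M => x) m := contMDiffAt_id
    refine this.congr_of_eventuallyEq ?_
    filter_upwards [(isClosed_extChartAt_symm_image hQ hQt).isOpen_compl.mem_nhds hm'] with x hx
      using chartExtension_of_notMem hfQ hx

theorem chartExtension_leftInverse {f f' : E → E} (hf : Function.Injective f)
    (hff' : ∀ y, f' (f y) = y) {k : M} {Q : Set E} (hQt : Q ⊆ (extChartAt I k).target)
    (hfQ : ∀ y ∉ Q, f y = y) (m : M) :
    chartExtension I k f' (chartExtension I k f m) = m := by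
  by_cases hm : m ∈ (extChartAt I k).source
  · have ht := mem_target_of_eq_self hf hQt hfQ ((extChartAt I k).map_source hm)
    rw [chartExtension_of_mem f hm, chartExtension_of_mem f' ((extChartAt I k).map_target ht),
      (extChartAt I k).right_inv ht, hff', (extChartAt I k).left_inv hm]
  · simp only [chartExtension, hm, if_false]

variable (I) in
/-- The extension by the identity of a diffeomorphism with compact support in a chart. -/
noncomputable def chartDiffeomorph [T2Space M] [IsManifold I 1 M] (k : M) (f : E ≃ₜ E)
    (hf : ContDiff ℝ 1 f) (hf' : ContDiff ℝ 1 f.symm) {Q : Set E} (hQ : IsCompact Q)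
    (hQt : Q ⊆ (extChartAt I k).target) (hfQ : ∀ y ∉ Q, f y = y) : M ≃ₘ^1⟮I, I⟯ M where
  toFun := chartExtension I k f
  invFun := chartExtension I k f.symm
  left_inv := chartExtension_leftInverse f.injective f.symm_apply_apply hQt hfQ
  right_inv := chartExtension_leftInverse f.symm.injective f.apply_symm_apply hQt fun y hy =>
    f.symm_apply_eq.2 (hfQ y hy).symm
  contMDiff_toFun := contMDiff_chartExtension f.injective hf hQ hQt hfQ
  contMDiff_invFun := contMDiff_chartExtension f.symm.injective hf' hQ hQt fun y hy =>
    f.symm_apply_eq.2 (hfQ y hy).symm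

theorem extChartAt_chartExtension {f : E → E} (hf : Function.Injective f) {k : M} {Q : Set E}
    (hQt : Q ⊆ (extChartAt I k).target) (hfQ : ∀ y ∉ Q, f y = y) {m : M}
    (hm : m ∈ (extChartAt I k).source) :
    extChartAt I k (chartExtension I k f m) = f (extChartAt I k m) := by
  rw [chartExtension_of_mem f hm, (extChartAt I k).right_inv
    (mem_target_of_eq_self hf hQt hfQ ((extChartAt I k).map_source hm))]

theorem chartExtension_mem_source {f : E → E} (hf : Function.Injective f) {k : M} {Q : Set E}
    (hQt : Q ⊆ (extChartAt I k).target) (hfQ : ∀ y ∉ Q, f y = y) {m : M}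
    (hm : m ∈ (extChartAt I k).source) :
    chartExtension I k f m ∈ (extChartAt I k).source := by
  rw [chartExtension_of_mem f hm]
  exact (extChartAt I k).map_target
    (mem_target_of_eq_self hf hQt hfQ ((extChartAt I k).map_source hm))

end ChartExtension

/-! ### Orientation-preserving maps on connected manifolds -/

section Orientation

variable {E : Type*} [NormedAddCommGroup E] [NormedSpace ℝ E]
  {H : Type*} [TopologicalSpace H] {I : ModelWithCorners ℝ E H}
  {M : Type*} [TopologicalSpace M] [ChartedSpace H M]

theorem CarriesOrientation.neg {ι V W : Type*} [AddCommGroup V] [Module ℝ V]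
    [AddCommGroup W] [Module ℝ W] {L : V →ₗ[ℝ] W} {o : Orientation ℝ V ι}
    {o' : Orientation ℝ W ι} (h : CarriesOrientation L o o') : CarriesOrientation L (-o) (-o') := by
  obtain ⟨e, rfl, rfl⟩ := h
  exact ⟨e, rfl, Orientation.map_neg e o⟩

theorem CarriesOrientation.eq_iff {ι V W : Type*} [AddCommGroup V] [Module ℝ V]
    [AddCommGroup W] [Module ℝ W] {L : V →ₗ[ℝ] W} {o₁ o₂ : Orientation ℝ V ι}
    {o₁' o₂' : Orientation ℝ W ι} (h₁ : CarriesOrientation L o₁ o₁')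
    (h₂ : CarriesOrientation L o₂ o₂') : o₁ = o₂ ↔ o₁' = o₂' := by
  obtain ⟨e₁, he₁, rfl⟩ := h₁
  obtain ⟨e₂, he₂, rfl⟩ := h₂
  have : e₁ = e₂ := LinearEquiv.toLinearMap_injective (he₁.trans he₂.symm)
  subst this
  exact (Orientation.map ι e₁).injective.eq_iff.symm

theorem CarriesOrientation.of_comp_eq {ι V W U : Type*} [AddCommGroup V] [Module ℝ V]
    [AddCommGroup W] [Module ℝ W] [AddCommGroup U] [Module ℝ U] {L : V →ₗ[ℝ] W}
    {L' : W →ₗ[ℝ] U} {o : Orientation ℝ V ι} {o' : Orientation ℝ W ι} {o'' : Orientation ℝ U ι}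
    (h' : CarriesOrientation L' o' o'') (h : CarriesOrientation (L' ∘ₗ L) o o'') :
    CarriesOrientation L o o' := by
  have h1 := h'
  obtain ⟨e, he, _⟩ := h1
  have h2 : CarriesOrientation (e.symm : U →ₗ[ℝ] W) o'' o' :=
    h'.of_leftInverse (by rw [← he]; ext; simp)
  have h3 := h2.comp h
  have : (e.symm : U →ₗ[ℝ] W) ∘ₗ (L' ∘ₗ L) = L := by
    rw [← he]; ext; simp
  rwa [this] at h3

/-- On a connected manifold, two orientations agree everywhere or nowhere. -/
theorem IsManifoldOrientation.eq_or_forall_ne [ConnectedSpace M]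
    {o o' : ∀ x : M, Orientation ℝ (TangentSpace I x) (Fin (finrank ℝ E))}
    (ho : IsManifoldOrientation I o) (ho' : IsManifoldOrientation I o') :
    o = o' ∨ ∀ x, o x ≠ o' x := by
  -- Near `x₀` the same chart differential carries both families to constants, and it is injective
  -- on orientations. So agreement is decided by the constants, and the set of agreement is clopen.
  have hloc : ∀ x₀, (∀ᶠ x in 𝓝 x₀, o x = o' x) ∨ ∀ᶠ x in 𝓝 x₀, o x ≠ o' x := by
    intro x₀
    obtain ⟨e, he⟩ := ho x₀
    obtain ⟨e', he'⟩ := ho' x₀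
    by_cases h : e = e'
    · left
      filter_upwards [he, he'] with x h1 h2 using (h1.eq_iff h2).2 h
    · right
      filter_upwards [he, he'] with x h1 h2 using fun h3 => h ((h1.eq_iff h2).1 h3)
  have hclopen : IsClopen {x | o x = o' x} := by
    constructor
    · rw [← isOpen_compl_iff, isOpen_iff_mem_nhds]
      intro x hx
      exact (hloc x).resolve_left fun h => hx h.self_of_nhds
    · rw [isOpen_iff_mem_nhds]
      intro x hx
      exact (hloc x).resolve_right fun h => h.self_of_nhds hx
  rcases isClopen_iff.1 hclopen with h | h
  · exact Or.inr fun x hx => by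
      have : x ∈ {x | o x = o' x} := hx
      rw [h] at this
      exact this
  · exact Or.inl (funext fun x => by
      have : x ∈ {x | o x = o' x} := h ▸ Set.mem_univ x
      exact this)

theorem orientation_eq_neg_of_ne [FiniteDimensional ℝ E]
    {o o' : Orientation ℝ E (Fin (finrank ℝ E))} (h : o ≠ o') : o = -o' :=
  (Orientation.eq_or_eq_neg o o' (by simp)).resolve_left h

/-- On a connected manifold it suffices to look at one orientation. -/
theorem isOrientationPreserving_of_orientation [FiniteDimensional ℝ E] [ConnectedSpace M]
    {o : ∀ x : M, Orientation ℝ (TangentSpace I x) (Fin (finrank ℝ E))}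
    (ho : IsManifoldOrientation I o) {g : M → M}
    (hg : ∀ x, CarriesOrientation (mfderiv I I g x).toLinearMap (o x) (o (g x))) :
    IsOrientationPreserving I g := by
  intro o' ho' x
  rcases ho'.eq_or_forall_ne ho with rfl | h
  · exact hg x
  · have hneg : ∀ y, o' y = -o y := fun y => orientation_eq_neg_of_ne (E := E) (h y)
    rw [hneg, hneg]
    exact (hg x).neg

/-- Over `Q` the chart intertwines the extension with `f`, whose differentials preserve `oE`, so the
chain rule transports this back. Elsewhere the map is locally the identity. -/
theorem isOrientationPreserving_chartExtension [FiniteDimensional ℝ E] [T2Space M]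
    [ConnectedSpace M] [IsManifold I 1 M]
    {o : ∀ x : M, Orientation ℝ (TangentSpace I x) (Fin (finrank ℝ E))}
    (ho : IsManifoldOrientation I o) {f : E → E} (hf : Function.Injective f)
    (hfc : ContDiff ℝ 1 f) (hdet : ∀ y, 0 < (fderiv ℝ f y).det) {k : M} {Q : Set E}
    (hQ : IsCompact Q) (hQt : Q ⊆ (extChartAt I k).target) (hfQ : ∀ y ∉ Q, f y = y)
    (oE : Orientation ℝ E (Fin (finrank ℝ E)))
    (hoE : ∀ x ∈ (extChartAt I k).symm '' Q, CarriesOrientation (V := TangentSpace I x) (W := E)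
      (mfderiv I 𝓘(ℝ, E) (extChartAt I k) x).toLinearMap (o x) oE) :
    IsOrientationPreserving I (chartExtension I k f) := by
  refine isOrientationPreserving_of_orientation ho fun m => ?_
  have hgd : MDifferentiable I I (chartExtension I k f) :=
    (contMDiff_chartExtension hf hfc hQ hQt hfQ).mdifferentiable one_ne_zero
  by_cases hm : m ∈ (extChartAt I k).symm '' Q
  · have hms : m ∈ (extChartAt I k).source := by
      obtain ⟨y, hy, rfl⟩ := hm
      exact (extChartAt I k).map_target (hQt hy)
    have hgm : chartExtension I k f m ∈ (extChartAt I k).symm '' Q := by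
      rw [chartExtension_of_mem f hms]
      obtain ⟨y, hy, rfl⟩ := hm
      rw [(extChartAt I k).right_inv (hQt hy)]
      exact ⟨_, mapsTo_of_eq_self hf hfQ hy, rfl⟩
    refine (hoE _ hgm).of_comp_eq ?_
    have hed : ∀ x ∈ (extChartAt I k).source, MDifferentiableAt I 𝓘(ℝ, E) (extChartAt I k) x :=
      fun x hx => mdifferentiableAt_extChartAt (extChartAt_source I k ▸ hx)
    have hfd : MDifferentiableAt 𝓘(ℝ, E) 𝓘(ℝ, E) f (extChartAt I k m) :=
      (hfc.differentiable one_ne_zero _).mdifferentiableAt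
    have heq : (extChartAt I k) ∘ chartExtension I k f =ᶠ[𝓝 m] f ∘ extChartAt I k := by
      filter_upwards [(isOpen_extChartAt_source (I := I) k).mem_nhds hms] with x hx
        using extChartAt_chartExtension hf hQt hfQ hx
    have h1 := mfderiv_comp m (hed _ (chartExtension_mem_source hf hQt hfQ hms)) (hgd m)
    have h2 := mfderiv_comp m hfd (hed m hms)
    have h3 : ((mfderiv I 𝓘(ℝ, E) (extChartAt I k) (chartExtension I k f m)).comp
        (mfderiv I I (chartExtension I k f) m) : E →L[ℝ] E) =
        (fderiv ℝ f (extChartAt I k m)).comp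
          (mfderiv I 𝓘(ℝ, E) (extChartAt I k) m : E →L[ℝ] E) := by
      refine h1.symm.trans ((heq.mfderiv_eq).trans (h2.trans ?_))
      rw [mfderiv_eq_fderiv]
      rfl
    have h4 : CarriesOrientation (fderiv ℝ f (extChartAt I k m)).toLinearMap oE oE := by
      let e := (fderiv ℝ f (extChartAt I k m)).toLinearMap.equivOfDetNeZero
        (hdet (extChartAt I k m)).ne'
      have he : (e : E →ₗ[ℝ] E) = (fderiv ℝ f (extChartAt I k m)).toLinearMap :=
        LinearMap.ext fun _ => rfl
      exact ⟨e, he, (orientation_map_eq_iff oE e).2 (he ▸ hdet _)⟩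
    have h5 := h4.comp (hoE m hm)
    have h6 := congrArg ContinuousLinearMap.toLinearMap h3
    exact Eq.mpr (congrArg
      (fun L : E →ₗ[ℝ] E => CarriesOrientation (V := E) (W := E) L (o m) oE) h6) h5
  · have heq : chartExtension I k f =ᶠ[𝓝 m] fun x => x := by
      filter_upwards [(isClosed_extChartAt_symm_image hQ hQt).isOpen_compl.mem_nhds hm] with x hx
        using chartExtension_of_notMem hfQ hx
    have h1 : (mfderiv I I (chartExtension I k f) m : E →L[ℝ] E) = ContinuousLinearMap.id ℝ E :=
      heq.mfderiv_eq.trans mfderiv_id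
    have h2 : (o (chartExtension I k f m) : Orientation ℝ E (Fin (finrank ℝ E))) = o m :=
      congrArg (show M → Orientation ℝ E (Fin (finrank ℝ E)) from o)
        (chartExtension_of_notMem hfQ hm)
    show CarriesOrientation (V := E) (W := E)
      (mfderiv I I (chartExtension I k f) m : E →L[ℝ] E).toLinearMap (o m)
      (o (chartExtension I k f m))
    rw [h1, h2]
    exact CarriesOrientation.id _

end Orientation

/-! ### Local defining functions of an immersed submanifold -/

section Slice

variable {E : Type*} [NormedAddCommGroup E] [NormedSpace ℝ E]
  {E' : Type*} [NormedAddCommGroup E'] [NormedSpace ℝ E'] [FiniteDimensional ℝ E'] {d : ℕ}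

/-- Near a point, the image of an immersion lies in the zero set of a `C¹` submersion whose
differential is a prescribed map vanishing on the tangent space of the image. -/
theorem exists_slice_function (ψ : E' → E) (z₀ : E') (hψ : ContDiffAt ℝ 1 ψ z₀)
    (hinj : Function.Injective (fderiv ℝ ψ z₀)) (b : E ≃ₗ[ℝ] (Fin d → ℝ) × (Fin 2 → ℝ))
    (hb : ∀ v, v ∈ Set.range (fderiv ℝ ψ z₀) ↔ (b v).2 = 0) :
    ∃ w : E → (Fin 2 → ℝ), ContDiffAt ℝ 1 w (ψ z₀) ∧
      (∀ v, fderiv ℝ w (ψ z₀) v = (b v).2) ∧ ∀ᶠ z in 𝓝 z₀, w (ψ z) = 0 := by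
  let j : (Fin 2 → ℝ) →L[ℝ] E := LinearMap.toContinuousLinearMap
    ((b.symm : _ →ₗ[ℝ] E) ∘ₗ LinearMap.inr ℝ (Fin d → ℝ) (Fin 2 → ℝ))
  have hj : ∀ w, b (j w) = (0, w) := fun w => by simp [j]
  have hD : ∀ z, (b (fderiv ℝ ψ z₀ z)).2 = 0 := fun z => (hb _).1 ⟨z, rfl⟩
  -- Thickening the immersion by a complement of its tangent space gives a local diffeomorphism. The
  -- second component of its inverse is the required function, and it vanishes where the second
  -- coordinate is 0, that is, on the image of `ψ`.
  let F : E' × (Fin 2 → ℝ) → E := fun p => ψ p.1 + j p.2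
  let F' : E' × (Fin 2 → ℝ) →L[ℝ] E := (fderiv ℝ ψ z₀).coprod j
  have hbF' : ∀ p, (b (F' p)).2 = p.2 := fun p => by
    simp only [F', ContinuousLinearMap.coprod_apply, map_add, Prod.snd_add, hD, hj, zero_add]
  have hbij : Function.Bijective F' := by
    constructor
    · rw [injective_iff_map_eq_zero]
      rintro ⟨z, w⟩ h
      have hw := hbF' (z, w)
      rw [h] at hw
      have hw' : w = 0 := by simpa using hw.symm
      subst hw'
      have hz : fderiv ℝ ψ z₀ z = 0 := by simpa [F'] using h
      have : z = 0 := hinj (by rw [hz, map_zero])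
      rw [this]; rfl
    · intro v
      obtain ⟨z, hz⟩ := (hb (v - j (b v).2)).2 (by rw [map_sub, hj]; simp)
      exact ⟨(z, (b v).2), by simp [F', hz]⟩
  let e : (E' × (Fin 2 → ℝ)) ≃L[ℝ] E :=
    (LinearEquiv.ofBijective F'.toLinearMap hbij).toContinuousLinearEquiv
  have he : ∀ p, e p = F' p := fun _ => rfl
  have hFc : ContDiffAt ℝ 1 F (z₀, 0) :=
    (ContDiffAt.comp (z₀, (0 : Fin 2 → ℝ)) (g := ψ) (f := Prod.fst) hψ contDiffAt_fst).add
      (j.contDiff.contDiffAt.comp _ contDiffAt_snd)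
  have hFd : HasFDerivAt F
      ((e : (E' × (Fin 2 → ℝ)) ≃L[ℝ] E) : E' × (Fin 2 → ℝ) →L[ℝ] E) (z₀, 0) := by
    have h1 : HasFDerivAt F ((fderiv ℝ ψ z₀).comp (ContinuousLinearMap.fst ℝ E' (Fin 2 → ℝ)) +
        j.comp (ContinuousLinearMap.snd ℝ E' (Fin 2 → ℝ))) (z₀, 0) :=
      (HasFDerivAt.comp (z₀, (0 : Fin 2 → ℝ)) (g := ψ) (f := Prod.fst)
        (hψ.differentiableAt one_ne_zero).hasFDerivAt hasFDerivAt_fst).add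
      (j.hasFDerivAt.comp _ hasFDerivAt_snd)
    convert h1 using 1
    ext p <;> simp [he, F']
  have hF0 : F (z₀, 0) = ψ z₀ := by simp [F]
  have hs := hFc.hasStrictFDerivAt' hFd one_ne_zero
  have hinvc := hFc.to_localInverse hFd one_ne_zero
  have hinvd := hs.to_localInverse.hasFDerivAt
  have hleft := hs.eventually_left_inverse
  rw [hF0] at hinvc hinvd
  refine ⟨fun y => (hFc.localInverse hFd one_ne_zero y).2, contDiffAt_snd.comp _ hinvc,
    fun v => ?_, ?_⟩
  · have h1 : HasFDerivAt (fun y => (hFc.localInverse hFd one_ne_zero y).2)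
        ((ContinuousLinearMap.snd ℝ E' (Fin 2 → ℝ)).comp (e.symm : E →L[ℝ] E' × (Fin 2 → ℝ)))
        (ψ z₀) := hasFDerivAt_snd.comp _ hinvd
    rw [h1.fderiv]
    have h2 := hbF' (e.symm v)
    rw [← he, e.apply_symm_apply] at h2
    exact h2.symm
  · have hc : Filter.Tendsto (fun z => (z, (0 : Fin 2 → ℝ))) (𝓝 z₀) (𝓝 (z₀, 0)) := by
      exact (Continuous.tendsto (by fun_prop) z₀)
    filter_upwards [hc.eventually hleft] with z hz
    have h1 : F (z, 0) = ψ z := by simp [F]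
    rw [h1] at hz
    exact congrArg Prod.snd hz

end Slice

/-! ### Realising linear maps as differentials of elements of Diff¹₊(M, K) -/

section Surjectivity

variable {E : Type*} [NormedAddCommGroup E] [NormedSpace ℝ E]
  {H : Type*} [TopologicalSpace H] {I : ModelWithCorners ℝ E H}
  {M : Type*} [TopologicalSpace M] [ChartedSpace H M]

/-- If `K` lies near an interior point `k` in the zero set of a `C¹` function `w`, then the small
perturbations of the identity along `w` are differentials of elements of `Diff¹₊(M, K)`. -/
theorem exists_diff1Plus_of_slice [FiniteDimensional ℝ E] [T2Space M] [ConnectedSpace M]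
    [IsManifold I 1 M]
    (hM : IsOrientableManifold I M) {K : Set M} {k : M} (hk : I.IsInteriorPoint k)
    {V : Type*} [NormedAddCommGroup V] [NormedSpace ℝ V] (w : E → V)
    (hw : ContDiffAt ℝ 1 w (extChartAt I k k))
    (hK : ∀ᶠ m in 𝓝 k, m ∈ K → w (extChartAt I k m) = 0)
    (hk0 : w (extChartAt I k k) = 0) :
    ∃ ε > 0, ∀ S : V →L[ℝ] E, ‖S‖ < ε → ∃ g : Diff1Plus I K, g.1 k = k ∧
      ∀ v : E, (mfderiv I I g.1 k : E →L[ℝ] E) v =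
        v + S (fderiv ℝ w (extChartAt I k k) v) := by
  obtain ⟨o, ho⟩ := hM
  obtain ⟨oE, hoE⟩ := ho k
  have hrange : Set.range I ∈ 𝓝 (extChartAt I k k) := mem_interior_iff_mem_nhds.1 hk
  have htarget : (extChartAt I k).target ∈ 𝓝 (extChartAt I k k) := by
    have := extChartAt_target_mem_nhdsWithin (I := I) k
    rwa [nhdsWithin_eq_nhds.2 hrange] at this
  have hsymm : Filter.Tendsto (extChartAt I k).symm (𝓝 (extChartAt I k k)) (𝓝 k) := by
    have := continuousAt_extChartAt_symm (I := I) k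
    rwa [ContinuousAt, extChartAt_to_inv] at this
  -- The supporting ball must lie where `w` is C¹, inside the chart target, where the chart reads
  -- the orientation as the constant `oE`, and where K is contained in the zeros of `w`.
  have hev := (hw.eventually (by simp)).and ((Filter.eventually_mem_set.2 htarget).and
    ((hsymm.eventually hoE).and (hsymm.eventually hK)))
  obtain ⟨r, hr, hball⟩ := Metric.nhds_basis_closedBall.mem_iff.1 hev
  let χ : ContDiffBump (extChartAt I k k) := ⟨r / 2, r, by positivity, by linarith⟩
  let Q : Set E := Metric.closedBall (extChartAt I k k) r
  have hQ : IsCompact Q := isCompact_closedBall _ _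
  have hQt : Q ⊆ (extChartAt I k).target := fun y hy => (hball hy).2.1
  -- The cut-off keeps the zeros of `w`, hence the points of K, fixed, and leaves `w` unchanged near
  -- `k`, so the differential there is the identity plus S composed with that of `w`.
  let ζ : E → V := fun y => χ y • w y
  have hχQ : ∀ y ∉ Q, χ y = 0 := fun y hy => χ.zero_of_le_dist (by
    have : ¬ dist y (extChartAt I k k) ≤ r := hy
    exact (not_le.1 this).le)
  have hζ : ContDiff ℝ 1 ζ := contDiff_iff_contDiffAt.2 fun y => by
    by_cases hy : y ∈ Q
    · exact χ.contDiff.contDiffAt.smul (hball hy).1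
    · have : ζ =ᶠ[𝓝 y] fun _ => 0 := by
        filter_upwards [hQ.isClosed.isOpen_compl.mem_nhds hy] with z hz
        show χ z • w z = 0
        rw [hχQ z hz, zero_smul]
      exact contDiffAt_const.congr_of_eventuallyEq this
  have hsupp : HasCompactSupport ζ := χ.hasCompactSupport.smul_right
  obtain ⟨ε, hε, hS⟩ := exists_homeomorph_id_add_comp ζ hζ hsupp
  refine ⟨ε, hε, fun S hSε => ?_⟩
  obtain ⟨f, hf, hfc, hfs, hdet⟩ := hS S hSε
  have hfQ : ∀ y ∉ Q, f y = y := fun y hy => by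
    rw [hf, show ζ y = χ y • w y from rfl, hχQ y hy, zero_smul, map_zero, add_zero]
  have hkeep : ∀ m ∈ K, chartExtension I k f m = m := by
    intro m hm
    by_cases hmQ : m ∈ (extChartAt I k).symm '' Q
    · obtain ⟨y, hy, rfl⟩ := hmQ
      have h1 := (hball hy).2.2.2 hm
      rw [(extChartAt I k).right_inv (hQt hy)] at h1
      rw [chartExtension_of_mem _ ((extChartAt I k).map_target (hQt hy)),
        (extChartAt I k).right_inv (hQt hy), hf]
      simp [ζ, h1]
    · exact chartExtension_of_notMem hfQ hmQ
  have hor : IsOrientationPreserving I (chartExtension I k f) :=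
    isOrientationPreserving_chartExtension ho f.injective hfc hdet hQ hQt hfQ oE (by
      rintro _ ⟨y, hy, rfl⟩
      exact (hball hy).2.2.1)
  have hfix : chartExtension I k f k = k := by
    rw [chartExtension_of_mem _ (mem_extChartAt_source k), hf]
    simp only [ζ, hk0, smul_zero, map_zero, add_zero]
    exact extChartAt_to_inv k
  refine ⟨⟨chartDiffeomorph I k f hfc hfs hQ hQt hfQ, hor, hkeep⟩, hfix, fun v => ?_⟩
  have hmd : MDifferentiableAt I I (chartExtension I k f) k :=
    (contMDiff_chartExtension f.injective hfc hQ hQt hfQ).mdifferentiable one_ne_zero k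
  have h1 := mfderiv_eq_fderivWithin_of_fixed hmd hfix
  rw [fderivWithin_of_mem_nhds hrange] at h1
  have h2 : extChartAt I k ∘ chartExtension I k f ∘ (extChartAt I k).symm =ᶠ[𝓝 (extChartAt I k k)]
      f := by
    filter_upwards [htarget] with y hy
    rw [Function.comp_apply, Function.comp_apply, extChartAt_chartExtension f.injective hQt hfQ
      ((extChartAt I k).map_target hy), (extChartAt I k).right_inv hy]
  rw [h2.fderiv_eq] at h1
  have h3 : ζ =ᶠ[𝓝 (extChartAt I k k)] w := by
    filter_upwards [χ.eventuallyEq_one] with y hy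
    show χ y • w y = w y
    rw [hy, Pi.one_apply, one_smul]
  have h4 : HasFDerivAt f (ContinuousLinearMap.id ℝ E +
      S.comp (fderiv ℝ w (extChartAt I k k))) (extChartAt I k k) := by
    rw [show (f : E → E) = fun y => y + S (ζ y) from funext hf]
    have h5 := ((hw.differentiableAt one_ne_zero).hasFDerivAt).congr_of_eventuallyEq h3
    exact (hasFDerivAt_id _).add (S.hasFDerivAt.comp _ h5)
  rw [h4.fderiv] at h1
  exact DFunLike.congr_fun h1 v

variable {E' : Type*} [NormedAddCommGroup E'] [NormedSpace ℝ E'] [FiniteDimensional ℝ E']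
  {H' : Type*} [TopologicalSpace H'] {J : ModelWithCorners ℝ E' H'}
  {N : Type*} [TopologicalSpace N] [ChartedSpace H' N]

/-- Near an interior point that is the image of an interior point, a closed submanifold of
codimension two lies in the zero set of a `C¹` submersion to the plane. -/
theorem IsClosedSmoothEmbedding.exists_slice_function {ι : N → M}
    (hι : IsClosedSmoothEmbedding I J ι) {x : N} (hx : J.IsInteriorPoint x) {d : ℕ}
    (b : E ≃ₗ[ℝ] (Fin d → ℝ) × (Fin 2 → ℝ))
    (hb : ∀ v : E, v ∈ Set.range (mfderiv J I ι x : E' →L[ℝ] E) ↔ (b v).2 = 0) :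
    ∃ w : E → (Fin 2 → ℝ), ContDiffAt ℝ 1 w (extChartAt I (ι x) (ι x)) ∧
      (∀ v, fderiv ℝ w (extChartAt I (ι x) (ι x)) v = (b v).2) ∧
      w (extChartAt I (ι x) (ι x)) = 0 ∧
      ∀ᶠ m in 𝓝 (ι x), m ∈ Set.range ι → w (extChartAt I (ι x) m) = 0 := by
  have hrange : Set.range J ∈ 𝓝 (extChartAt J x x) := mem_interior_iff_mem_nhds.1 hx
  let ψ : E' → E := extChartAt I (ι x) ∘ ι ∘ (extChartAt J x).symm
  have hψ : ContDiffAt ℝ 1 ψ (extChartAt J x x) :=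
    ((contMDiffAt_iff.1 (hι.contMDiff x)).2.contDiffAt hrange).of_le (by simp)
  have hd : (mfderiv J I ι x : E' →L[ℝ] E) = fderiv ℝ ψ (extChartAt J x x) := by
    refine ((hι.contMDiff.mdifferentiable (by simp) x).mfderiv).trans ?_
    rw [fderivWithin_of_mem_nhds hrange]
    rfl
  have hψx : ψ (extChartAt J x x) = extChartAt I (ι x) (ι x) := by
    simp only [ψ, Function.comp_apply, extChartAt_to_inv]
  have hinj : Function.Injective (mfderiv J I ι x : E' →L[ℝ] E) := hι.injective_mfderiv x
  rw [hd] at hinj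
  obtain ⟨w, hw, hwd, hw0⟩ := _root_.exists_slice_function ψ (extChartAt J x x) hψ hinj b
    (fun v => by rw [← hd]; exact hb v)
  have hev : ∀ᶠ y in 𝓝 x, w (extChartAt I (ι x) (ι y)) = 0 := by
    filter_upwards [(continuousAt_extChartAt (I := J) x).eventually hw0,
      extChartAt_source_mem_nhds (I := J) x] with y hy hys
    simpa only [ψ, Function.comp_apply, (extChartAt J x).left_inv hys] using hy
  rw [hψx] at hw hwd
  refine ⟨w, hw, hwd, hev.self_of_nhds, ?_⟩
  -- The embedding property ensures that points of K near `ι x` come only from points of N near `x`;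
  -- an injective immersion alone could return.
  rw [hι.isClosedEmbedding.isInducing.nhds_eq_comap, Filter.eventually_comap] at hev
  filter_upwards [hev] with m hm
  rintro ⟨y, rfl⟩
  exact hm y rfl

/-- If the differentials of a group contain all small perturbations of the identity along the
projection to the plane, then the homomorphism to `ℝ^{2d} ⋊ GL⁺(2, ℝ)` is surjective. -/
theorem surjective_of_small_perturbations [FiniteDimensional ℝ E] {d : ℕ}
    (b : E ≃ₗ[ℝ] (Fin d → ℝ) × (Fin 2 → ℝ))
    {Γ : Type*} [Group Γ] (D : Γ → E → E) (ρ : Γ →* KnotLinearGroup d)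
    (hρ : ∀ g v, b (D g v) = knotLinearAct (ρ g) (b v)) {ε : ℝ} (hε : 0 < ε)
    (h : ∀ S : (Fin 2 → ℝ) →L[ℝ] E, ‖S‖ < ε → ∃ g, ∀ v, D g v = v + S (b v).2) :
    Function.Surjective ρ := by
  rw [← MonoidHom.range_eq_top]
  refine knotLinearGroup_subgroup_eq_top _ ?_
  -- The block matrix with blocks B and A is the identity plus the perturbation given by (B, A - 1),
  -- which is small when (B, A) is near (0, 1).
  let θ : Matrix (Fin d) (Fin 2) ℝ × Matrix (Fin 2) (Fin 2) ℝ → (Fin 2 → ℝ) →L[ℝ] E := fun q =>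
    LinearMap.toContinuousLinearMap
      ((b.symm : _ →ₗ[ℝ] E) ∘ₗ (Matrix.toLin' q.1).prod (Matrix.toLin' q.2))
  have hθ : ∀ q v, b (θ q v) = (q.1 *ᵥ v, q.2 *ᵥ v) := fun q v => by
    show b (b.symm (Matrix.toLin' q.1 v, Matrix.toLin' q.2 v)) = _
    rw [b.apply_symm_apply, Matrix.toLin'_apply, Matrix.toLin'_apply]
  let Θ : Matrix (Fin d) (Fin 2) ℝ × Matrix (Fin 2) (Fin 2) ℝ →ₗ[ℝ] (Fin 2 → ℝ) →L[ℝ] E :=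
    { toFun := θ
      map_add' := fun q q' => ContinuousLinearMap.ext fun v => b.injective <| by
        rw [add_apply, map_add, hθ, hθ, hθ]
        exact Prod.ext (Matrix.add_mulVec q.1 q'.1 v) (Matrix.add_mulVec q.2 q'.2 v)
      map_smul' := fun c q => ContinuousLinearMap.ext fun v => b.injective <| by
        rw [RingHom.id_apply, smul_apply, map_smul, hθ, hθ]
        exact Prod.ext (Matrix.smul_mulVec c q.1 v) (Matrix.smul_mulVec c q.2 v) }
  have hΘ : ∀ q v, b (Θ q v) = (q.1 *ᵥ v, q.2 *ᵥ v) := hθ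
  have hΘc : Continuous Θ := Θ.continuous_of_finiteDimensional
  have hc : Continuous fun q : Matrix (Fin d) (Fin 2) ℝ × Matrix (Fin 2) (Fin 2) ℝ =>
      ‖Θ (q.1, q.2 - 1)‖ := by fun_prop
  have h0 : ‖Θ ((0 : Matrix (Fin d) (Fin 2) ℝ), (1 : Matrix (Fin 2) (Fin 2) ℝ) - 1)‖ < ε := by
    rw [sub_self, Prod.mk_zero_zero, map_zero, norm_zero]
    exact hε
  filter_upwards [(hc.tendsto (0, 1)).eventually (gt_mem_nhds h0)] with q hq hdet
  obtain ⟨g, hg⟩ := h _ hq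
  refine ⟨g, knotLinearAct_injective (funext fun v => ?_)⟩
  obtain ⟨v, rfl⟩ := b.surjective v
  rw [← hρ, hg, map_add, hΘ, knotLinearAct_knotOfBlocks]
  rw [Matrix.sub_mulVec, Matrix.one_mulVec]
  exact Prod.ext rfl (add_sub_cancel _ _)

end Surjectivity


theorem mainTheorem5 {d : ℕ}
    -- the manifold `M`, of dimension `n = d + 2`
    {E : Type*} [NormedAddCommGroup E] [NormedSpace ℝ E] [FiniteDimensional ℝ E]
    (hE : finrank ℝ E = d + 2)
    {H : Type*} [TopologicalSpace H] (I : ModelWithCorners ℝ E H)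
    {M : Type*} [TopologicalSpace M] [T2Space M] [SecondCountableTopology M] [ConnectedSpace M]
    [ChartedSpace H M] [IsManifold I ∞ M] (hM : IsOrientableManifold I M)
    -- the submanifold `K = ι(N)`, of dimension `d = n - 2`
    {E' : Type*} [NormedAddCommGroup E'] [NormedSpace ℝ E'] [FiniteDimensional ℝ E']
    (hE' : finrank ℝ E' = d)
    {H' : Type*} [TopologicalSpace H'] (J : ModelWithCorners ℝ E' H')
    {N : Type*} [TopologicalSpace N] [Nonempty N] [ChartedSpace H' N] [IsManifold J ∞ N]
    (ι : N → M) (hι : IsClosedSmoothEmbedding I J ι) :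
    IsCircularlyOrderable (Diff1Plus I (Set.range ι)) ∧
    IsCircularlyOrderable (KnotLinearGroup d) ∧
    ∀ x : N,
      -- linear coordinates on the tangent space of `M` at `ι x` in which that of `K` is `ℝ^d × 0`
      ∃ b : TangentSpace I (ι x) ≃ₗ[ℝ] (Fin d → ℝ) × (Fin 2 → ℝ),
        (∀ v : TangentSpace I (ι x), v ∈ Set.range (mfderiv J I ι x) ↔ (b v).2 = 0) ∧
        ∃ ρ : Diff1Plus I (Set.range ι) →* KnotLinearGroup d,
          -- `ρ g` is the differential of `g` at the fixed point `ι x`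
          (∀ (g : Diff1Plus I (Set.range ι)) (v : TangentSpace I (ι x)),
            b (mfderiv I I g.1 (ι x) v) = knotLinearAct (ρ g) (b v)) ∧
          IsLocallyIndicable ρ.ker ∧
          (J.IsInteriorPoint x → I.IsInteriorPoint (ι x) → Function.Surjective ρ) := by
  have key : ∀ x : N,
      ∃ b : TangentSpace I (ι x) ≃ₗ[ℝ] (Fin d → ℝ) × (Fin 2 → ℝ),
        (∀ v : TangentSpace I (ι x), v ∈ Set.range (mfderiv J I ι x) ↔ (b v).2 = 0) ∧
        ∃ ρ : Diff1Plus I (Set.range ι) →* KnotLinearGroup d,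
          (∀ (g : Diff1Plus I (Set.range ι)) (v : TangentSpace I (ι x)),
            b (mfderiv I I g.1 (ι x) v) = knotLinearAct (ρ g) (b v)) ∧
          IsLocallyIndicable ρ.ker ∧
          (J.IsInteriorPoint x → I.IsInteriorPoint (ι x) → Function.Surjective ρ) := by
    intro x
    have hιd : MDifferentiableAt J I ι x := hι.contMDiff.mdifferentiable (by simp) x
    obtain ⟨b, hb⟩ := exists_coordinates_range (E := E) hE hE'
      (mfderiv J I ι x : E' →L[ℝ] E).toLinearMap (hι.injective_mfderiv x)
    have hfix : ∀ (g : Diff1Plus I (Set.range ι)) (v : E), (b v).2 = 0 →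
        (mfderiv I I g.1 (ι x) : E →L[ℝ] E) v = v := by
      intro g v hv
      obtain ⟨z, rfl⟩ := (hb v).2 hv
      -- Differentiating g ∘ ι = ι shows that the differential of g fixes the tangent space of K
      -- pointwise.
      have hcomp : (⇑g.1 ∘ ι) = ι := funext fun y => g.2.2 _ ⟨y, rfl⟩
      have hc : mfderiv J I (⇑g.1 ∘ ι) x = (mfderiv I I g.1 (ι x)).comp (mfderiv J I ι x) :=
        mfderiv_comp x (g.1.mdifferentiable one_ne_zero _) hιd
      have hc' : (mfderiv J I (⇑g.1 ∘ ι) x : E' →L[ℝ] E) = mfderiv J I ι x := by rw [hcomp]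
      exact DFunLike.congr_fun (hc.symm.trans hc' :
        (mfderiv I I g.1 (ι x) : E →L[ℝ] E).comp (mfderiv J I ι x : E' →L[ℝ] E) =
          mfderiv J I ι x) z
    obtain ⟨ρ, hρ, hker⟩ := exists_knotHom hM (Set.range ι) (ι x) ⟨x, rfl⟩ b hfix
    refine ⟨b, hb, ρ, hρ, hker, fun hx hk => ?_⟩
    obtain ⟨w, hw, hwd, hw0, hwK⟩ := hι.exists_slice_function hx b hb
    obtain ⟨ε, hε, hS⟩ := exists_diff1Plus_of_slice hM hk w hw hwK hw0
    refine surjective_of_small_perturbations b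
      (fun g : Diff1Plus I (Set.range ι) => (mfderiv I I g.1 (ι x) : E →L[ℝ] E)) ρ hρ hε
      fun S hSε => ?_
    obtain ⟨g, _, hg⟩ := hS S hSε
    exact ⟨g, fun v => by rw [hg, hwd]⟩
  refine ⟨?_, isCircularlyOrderable_knotLinearGroup d, key⟩
  -- Any single point of K suffices to pull back the circular order; no interior point is needed.
  obtain ⟨x⟩ := ‹Nonempty N›
  obtain ⟨_, _, ρ, _, hρ, _⟩ := key x
  exact (isCircularlyOrderable_knotLinearGroup d).of_hom ρ hρ.isLeftOrderable
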